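/- Let $\Gamma$ be a (not necessarily commutative) group with identity $e$ and let $R=\bigoplus_{\gamma\in\Gamma}R_\gamma$ be a $\Gamma$-graded ring (associative, with $1$). **Matrices.** An $m\times n$ matrix $A$ over $R$ has distribution $(\overline\alpha,\overline\beta)\in\Gamma^m\times\Gamma^n$ if $A_{ij}\in R_{\alpha_i\beta_j^{-1}}$ for all $i,j$; it is homogeneous if it has some distribution. Let $\mathfrak M_\bullet(R)$ be the set of homogeneous matrices of all sizes and $\mathfrak M(R)$ the set of square ones (empty matrices are allowed). A matrix $A\in\mathfrak M(R)$ of size $n$ is gr-full if $A=PQ$, with $P$ of size $n\times r$ and distribution $(\overline\alpha,\overline\lambda)$ and $Q$ of size $r\times n$ and distribution $(\overline\lambda,\overline\beta)$, implies $r\ge n$. Write $A\oplus B=\begin{pmatrix}A&0\\0&B\end{pmatrix}$. If $A,B\in\mathfrak M(R)$ have the same size and a common distribution and differ at most in the $i$-th column (row), their determinantal sum $A\nabla B$ is the matrix that agrees with them except that its $i$-th column (row) is the sum of theirs. **gr-prime matrix ideals.** A gr-prime matrix ideal of $R$ is a subset $\mathcal P\subseteq\mathfrak M(R)$ such that: (PM1)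 every $A\in\mathfrak M(R)$ that is not gr-full is in $\mathcal P$; (PM2) if $A,B\in\mathcal P$ and $A\nabla B$ is defined (for a column or a row), then $A\nabla B\in\mathcal P$; (PM3) if $A\in\mathcal P$ and $B\in\mathfrak M(R)$, then $A\oplus B\in\mathcal P$; (PM4) if $A,B\in\mathfrak M(R)$ and $A\oplus B\in\mathcal P$, then $A\in\mathcal P$ or $B\in\mathcal P$; (PM5) the $1\times1$ matrix $(1)$ is not in $\mathcal P$; (PM6) if $A\in\mathcal P$ and $E,F$ are permutation matrices of the size of $A$, then $EAF\in\mathcal P$. They are ordered by inclusion. **gr-Sylvester matrix rank functions.** A gr-Sylvester matrix rank function for $R$ is a map $\mathrm{rk}\colon\mathfrak M_\bullet(R)\to\mathbb N$ such that: (1) $\mathrm{rk}((1))=1$; (2) $\mathrm{rk}(AB)\le\min\{\mathrm{rk}(A),\mathrm{rk}(B)\}$ whenever $A$ has distribution $(\overline\alpha,\overline\beta)$ and $B$ has distribution $(\overline\beta,\overline\varepsilon)$; (3) $\mathrm{rk}(A\oplus B)=\mathrm{rk}(A)+\mathrm{rk}(B)$ for all $A,B\in\mathfrak M_\bullet(R)$;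 (4) $\mathrm{rk}\begin{pmatrix}A&C\\0&B\end{pmatrix}\ge\mathrm{rk}(A)+\mathrm{rk}(B)$ whenever $A,B,C$ have distributions $(\overline\alpha,\overline\beta)$, $(\overline\delta,\overline\varepsilon)$, $(\overline\alpha,\overline\varepsilon)$. They are ordered pointwise. **Graded division rings.** A $\Gamma$-graded epic $R$-division ring is a pair $(K,\varphi)$, where $K$ is a nonzero $\Gamma$-graded ring all of whose nonzero homogeneous elements are invertible, and $\varphi\colon R\to K$ is a homomorphism of $\Gamma$-graded rings such that $K$ is the least subring of $K$ that contains $\varphi(R)$ and is closed under inversion of homogeneous elements. Its gr-singular kernel is $\{A\in\mathfrak M(R): A^\varphi\text{ is not invertible over }K\}$, where $A^\varphi$ is $A$ with $\varphi$ applied to its entries. For a matrix $M$ over $K$ with distribution $(\overline\alpha,\overline\beta)$, $\mathrm{drank}(M)$ is the dimension of the right $K$-module spanned by its columns, i.e. the number of elements of a homogeneous basis of that graded submodule of $K(\alpha_1)\oplus\dots\oplus K(\alpha_m)$, where $K(\alpha)_\gamma=K_{\alpha\gamma}$. **Theorem.** There is an order-reversing bijection, with order-reversing inverse (an anti-isomorphism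 of partially ordered sets), $\mathcal P\mapsto\mathrm{rk}_{\mathcal P}$ from the set of gr-prime matrix ideals of $R$ onto the set of gr-Sylvester matrix rank functions for $R$ such that: (a) for every gr-prime matrix ideal $\mathcal P$ and every $A\in\mathfrak M_\bullet(R)$, $\mathrm{rk}_{\mathcal P}(A)$ is the size of the largest square submatrix of $A$ (obtained by deleting rows and/or columns) that is not in $\mathcal P$; equivalently, if $(K,\varphi)$ is a $\Gamma$-graded epic $R$-division ring with gr-singular kernel $\mathcal P$, then $\mathrm{rk}_{\mathcal P}(A)=\mathrm{drank}(A^\varphi)$; (b) the inverse bijection sends a gr-Sylvester matrix rank function $\mathrm{rk}$ to the gr-prime matrix ideal $\{A\in\mathfrak M(R):\mathrm{rk}(A)<\text{size of }A\}$. -/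

import Mathlib

/-!
# Homogeneous matrices, gr-prime matrix ideals and gr-Sylvester matrix rank functions

The grading group `Γ` is an arbitrary, possibly noncommutative, group. It is written additively,
because that is the convention of Mathlib's `GradedRing`; thus the degree `α_i * β_j⁻¹` of
multiplicative notation reads `α i - β j`, which is `α i + -β j`.
-/

section HomogeneousMatrices

variable {Γ : Type*} [AddGroup Γ] {R : Type*} [Ring R]

/-- `A` has distribution `(α, β)`: its `(i, j)` entry lies in the component of degree
`α i - β j`. -/
def HasDistribution (𝒜 : Γ → AddSubgroup R) {m n : ℕ} (A : Matrix (Fin m) (Fin n) R)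
    (α : Fin m → Γ) (β : Fin n → Γ) : Prop :=
  ∀ i j, A i j ∈ 𝒜 (α i - β j)

/-- `A` is a homogeneous matrix: it has some distribution (which need not be unique). -/
def IsHomogeneousMatrix (𝒜 : Γ → AddSubgroup R) {m n : ℕ} (A : Matrix (Fin m) (Fin n) R) : Prop :=
  ∃ (α : Fin m → Γ) (β : Fin n → Γ), HasDistribution 𝒜 A α β

/-- The set of homogeneous `m × n` matrices. -/
abbrev HomogeneousMatrix (𝒜 : Γ → AddSubgroup R) (m n : ℕ) : Type _ :=
  {A : Matrix (Fin m) (Fin n) R // IsHomogeneousMatrix 𝒜 A}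

/-- The block matrix with rows `(A, C)` and `(0, B)`. -/
def upperBlock {m n m' n' : ℕ} (A : Matrix (Fin m) (Fin n) R) (C : Matrix (Fin m) (Fin n') R)
    (B : Matrix (Fin m') (Fin n') R) : Matrix (Fin (m + m')) (Fin (n + n')) R :=
  (Matrix.fromBlocks A C 0 B).reindex finSumFinEquiv finSumFinEquiv

/-- The diagonal sum `A ⊕ B`, the block matrix with rows `(A, 0)` and `(0, B)`. -/
def diagSum {m n m' n' : ℕ} (A : Matrix (Fin m) (Fin n) R) (B : Matrix (Fin m') (Fin n') R) :
    Matrix (Fin (m + m')) (Fin (n + n')) R :=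
  upperBlock A 0 B

/-- A square matrix is gr-full if every factorization `A = P * Q` into homogeneous matrices with
distributions `(α, ν)` and `(ν, β)` has inner size at least the size of `A`. -/
def IsGrFull (𝒜 : Γ → AddSubgroup R) {n : ℕ} (A : Matrix (Fin n) (Fin n) R) : Prop :=
  ∀ (r : ℕ) (α β : Fin n → Γ) (ν : Fin r → Γ)
    (P : Matrix (Fin n) (Fin r) R) (Q : Matrix (Fin r) (Fin n) R),
    HasDistribution 𝒜 P α ν → HasDistribution 𝒜 Q ν β → A = P * Q → n ≤ r

theorem HasDistribution.upperBlock {𝒜 : Γ → AddSubgroup R} {m n m' n' : ℕ}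
    {A : Matrix (Fin m) (Fin n) R} {C : Matrix (Fin m) (Fin n') R}
    {B : Matrix (Fin m') (Fin n') R} {α : Fin m → Γ} {β : Fin n → Γ} {δ : Fin m' → Γ}
    {ε : Fin n' → Γ} (hA : HasDistribution 𝒜 A α β) (hC : HasDistribution 𝒜 C α ε)
    (hB : HasDistribution 𝒜 B δ ε) :
    HasDistribution 𝒜 (upperBlock A C B) (Fin.append α δ) (Fin.append β ε) := by
  intro i j
  refine Fin.addCases (fun i => ?_) (fun i => ?_) i <;>
    refine Fin.addCases (fun j => ?_) (fun j => ?_) j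
  · simpa [_root_.upperBlock] using hA i j
  · simpa [_root_.upperBlock] using hC i j
  · simp [_root_.upperBlock, (𝒜 _).zero_mem]
  · simpa [_root_.upperBlock] using hB i j

theorem IsHomogeneousMatrix.diagSum {𝒜 : Γ → AddSubgroup R} {m n m' n' : ℕ}
    {A : Matrix (Fin m) (Fin n) R} {B : Matrix (Fin m') (Fin n') R}
    (hA : IsHomogeneousMatrix 𝒜 A) (hB : IsHomogeneousMatrix 𝒜 B) :
    IsHomogeneousMatrix 𝒜 (diagSum A B) := by
  obtain ⟨α, β, hA⟩ := hA
  obtain ⟨δ, ε, hB⟩ := hB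
  exact ⟨_, _, hA.upperBlock (fun _ _ => (𝒜 _).zero_mem) hB⟩

theorem HasDistribution.mul {𝒜 : Γ → AddSubgroup R} [SetLike.GradedMonoid 𝒜] {m n p : ℕ}
    {A : Matrix (Fin m) (Fin n) R} {B : Matrix (Fin n) (Fin p) R}
    {α : Fin m → Γ} {β : Fin n → Γ} {ε : Fin p → Γ}
    (hA : HasDistribution 𝒜 A α β) (hB : HasDistribution 𝒜 B β ε) :
    HasDistribution 𝒜 (A * B) α ε := by
  intro i j
  rw [Matrix.mul_apply]
  refine sum_mem fun k _ => ?_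
  have h := SetLike.mul_mem_graded (hA i k) (hB k j)
  rwa [sub_add_sub_cancel] at h

theorem isHomogeneousMatrix_one {𝒜 : Γ → AddSubgroup R} [SetLike.GradedMonoid 𝒜] (n : ℕ) :
    IsHomogeneousMatrix 𝒜 (1 : Matrix (Fin n) (Fin n) R) := by
  refine ⟨fun _ => 0, fun _ => 0, fun i j => ?_⟩
  rw [Matrix.one_apply, sub_zero]
  split_ifs
  · exact SetLike.GradedOne.one_mem
  · exact (𝒜 _).zero_mem

end HomogeneousMatrices

section PrimeMatrixIdeals

variable {Γ : Type*} [AddGroup Γ] {R : Type*} [Ring R]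

/-- A gr-prime matrix ideal: a set of homogeneous square matrices (`carrier n` holds those of size
`n × n`) with the following properties. -/
@[ext]
structure GrPrimeMatrixIdeal (𝒜 : Γ → AddSubgroup R) where
  carrier : (n : ℕ) → Set (Matrix (Fin n) (Fin n) R)
  isHomogeneous : ∀ {n : ℕ} {A : Matrix (Fin n) (Fin n) R},
    A ∈ carrier n → IsHomogeneousMatrix 𝒜 A
  not_grFull_mem : ∀ {n : ℕ} {A : Matrix (Fin n) (Fin n) R},
    IsHomogeneousMatrix 𝒜 A → ¬ IsGrFull 𝒜 A → A ∈ carrier n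
  /-- Closure under determinantal sums with respect to a column. -/
  col_sum_mem : ∀ {n : ℕ} {A B : Matrix (Fin n) (Fin n) R} {α β : Fin n → Γ} (k : Fin n),
    HasDistribution 𝒜 A α β → HasDistribution 𝒜 B α β →
    (∀ i j, j ≠ k → A i j = B i j) →
    A ∈ carrier n → B ∈ carrier n → A.updateCol k (A.col k + B.col k) ∈ carrier n
  /-- Closure under determinantal sums with respect to a row. -/
  row_sum_mem : ∀ {n : ℕ} {A B : Matrix (Fin n) (Fin n) R} {α β : Fin n → Γ} (k : Fin n),
    HasDistribution 𝒜 A α β → HasDistribution 𝒜 B α β →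
    (∀ i j, i ≠ k → A i j = B i j) →
    A ∈ carrier n → B ∈ carrier n → A.updateRow k (A.row k + B.row k) ∈ carrier n
  diagSum_mem : ∀ {m n : ℕ} {A : Matrix (Fin m) (Fin m) R} {B : Matrix (Fin n) (Fin n) R},
    A ∈ carrier m → IsHomogeneousMatrix 𝒜 B → diagSum A B ∈ carrier (m + n)
  mem_or_mem : ∀ {m n : ℕ} {A : Matrix (Fin m) (Fin m) R} {B : Matrix (Fin n) (Fin n) R},
    IsHomogeneousMatrix 𝒜 A → IsHomogeneousMatrix 𝒜 B →
    diagSum A B ∈ carrier (m + n) → A ∈ carrier m ∨ B ∈ carrier n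
  one_notMem : (1 : Matrix (Fin 1) (Fin 1) R) ∉ carrier 1
  perm_mem : ∀ {n : ℕ} {A : Matrix (Fin n) (Fin n) R} (σ τ : Equiv.Perm (Fin n)),
    A ∈ carrier n → σ.permMatrix R * A * τ.permMatrix R ∈ carrier n

/-- gr-prime matrix ideals are ordered by inclusion. -/
instance (𝒜 : Γ → AddSubgroup R) : PartialOrder (GrPrimeMatrixIdeal 𝒜) where
  le P Q := ∀ n, P.carrier n ⊆ Q.carrier n
  le_refl _ _ := subset_rfl
  le_trans _ _ _ h₁ h₂ n := (h₁ n).trans (h₂ n)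
  le_antisymm _ _ h₁ h₂ := GrPrimeMatrixIdeal.ext (funext fun n => (h₁ n).antisymm (h₂ n))

end PrimeMatrixIdeals

section RankFunctions

variable {Γ : Type*} [AddGroup Γ] {R : Type*} [Ring R]

/-- A gr-Sylvester matrix rank function: a map from the set of all homogeneous matrices (of all
sizes, not necessarily square) to `ℕ` with the following properties. -/
@[ext]
structure GrSylvesterMatrixRank (𝒜 : Γ → AddSubgroup R) [SetLike.GradedMonoid 𝒜] where
  rk : (m n : ℕ) → HomogeneousMatrix 𝒜 m n → ℕ
  rk_one : rk 1 1 ⟨1, isHomogeneousMatrix_one 1⟩ = 1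
  rk_mul_le : ∀ {m n p : ℕ} {A : Matrix (Fin m) (Fin n) R} {B : Matrix (Fin n) (Fin p) R}
    {α : Fin m → Γ} {β : Fin n → Γ} {ε : Fin p → Γ}
    (hA : HasDistribution 𝒜 A α β) (hB : HasDistribution 𝒜 B β ε),
    rk m p ⟨A * B, α, ε, hA.mul hB⟩ ≤ min (rk m n ⟨A, α, β, hA⟩) (rk n p ⟨B, β, ε, hB⟩)
  rk_diagSum : ∀ {m n m' n' : ℕ} (A : HomogeneousMatrix 𝒜 m n) (B : HomogeneousMatrix 𝒜 m' n'),
    rk (m + m') (n + n') ⟨diagSum A.1 B.1, A.2.diagSum B.2⟩ = rk m n A + rk m' n' B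
  le_rk_upperBlock : ∀ {m n m' n' : ℕ}
    {A : Matrix (Fin m) (Fin n) R} {C : Matrix (Fin m) (Fin n') R}
    {B : Matrix (Fin m') (Fin n') R} {α : Fin m → Γ} {β : Fin n → Γ} {δ : Fin m' → Γ}
    {ε : Fin n' → Γ} (hA : HasDistribution 𝒜 A α β) (hC : HasDistribution 𝒜 C α ε)
    (hB : HasDistribution 𝒜 B δ ε),
    rk m n ⟨A, α, β, hA⟩ + rk m' n' ⟨B, δ, ε, hB⟩ ≤
      rk (m + m') (n + n') ⟨upperBlock A C B, _, _, hA.upperBlock hC hB⟩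

/-- gr-Sylvester matrix rank functions are ordered pointwise. -/
instance (𝒜 : Γ → AddSubgroup R) [SetLike.GradedMonoid 𝒜] :
    PartialOrder (GrSylvesterMatrixRank 𝒜) where
  le ρ ρ' := ∀ (m n : ℕ) (A : HomogeneousMatrix 𝒜 m n), ρ.rk m n A ≤ ρ'.rk m n A
  le_refl _ _ _ _ := le_rfl
  le_trans _ _ _ h₁ h₂ m n A := (h₁ m n A).trans (h₂ m n A)
  le_antisymm _ _ h₁ h₂ := GrSylvesterMatrixRank.ext
    (funext fun m => funext fun n => funext fun A => (h₁ m n A).antisymm (h₂ m n A))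

end RankFunctions

section GradedDivisionRings

variable {Γ : Type*} [AddGroup Γ] {R : Type*} [Ring R] {K : Type*} [Ring K]

/-- A graded division ring: a nonzero graded ring in which every nonzero homogeneous element is
invertible. -/
def IsGradedDivisionRing (𝒦 : Γ → AddSubgroup K) : Prop :=
  Nontrivial K ∧ ∀ x : K, SetLike.IsHomogeneousElem 𝒦 x → x ≠ 0 → IsUnit x

/-- The graded division closure of `φ`: the least subring of the graded ring `K` that contains the
image of `φ` and is closed under inversion of homogeneous elements. -/
def gradedDivisionClosure {𝒜 : Γ → AddSubgroup R} {𝒦 : Γ → AddSubgroup K}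
    (φ : 𝒜 →+*ᵍ 𝒦) : Subring K :=
  sInf {S | (∀ r, φ r ∈ S) ∧
    ∀ x y : K, SetLike.IsHomogeneousElem 𝒦 x → x * y = 1 → y * x = 1 → x ∈ S → y ∈ S}

/-- `(K, φ)` is a graded epic `R`-division ring: `K` is a graded division ring and it is generated,
as a graded division ring, by the image of `φ`. -/
def IsGradedEpicDivisionRing {𝒜 : Γ → AddSubgroup R} {𝒦 : Γ → AddSubgroup K}
    (φ : 𝒜 →+*ᵍ 𝒦) : Prop :=
  IsGradedDivisionRing 𝒦 ∧ gradedDivisionClosure φ = ⊤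

/-- The gr-singular kernel of `(K, φ)`: the homogeneous square matrices over `R` whose image over
`K` is not invertible. -/
def grSingularKernel {𝒜 : Γ → AddSubgroup R} {𝒦 : Γ → AddSubgroup K}
    (φ : 𝒜 →+*ᵍ 𝒦) (n : ℕ) : Set (Matrix (Fin n) (Fin n) R) :=
  {A | IsHomogeneousMatrix 𝒜 A ∧ ¬ IsUnit (A.map φ)}

/-- The submodule `N` of the graded free right `K`-module `K(α 0) ⊕ ⋯ ⊕ K(α (m - 1))` has
dimension `r`: it has a homogeneous basis with `r` elements. Right modules are modules over `Kᵐᵒᵖ`,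
and a vector `v` is homogeneous of degree `γ` if `v i` has degree `α i + γ` for all `i`. (Bases
that are not homogeneous are left out on purpose: `Module.finrank` is not the dimension here.) -/
def HasGradedDim (𝒦 : Γ → AddSubgroup K) {m : ℕ} (α : Fin m → Γ)
    (N : Submodule Kᵐᵒᵖ (Fin m → K)) (r : ℕ) : Prop :=
  ∃ b : Module.Basis (Fin r) Kᵐᵒᵖ N, ∀ k, ∃ γ, ∀ i, (b k : Fin m → K) i ∈ 𝒦 (α i + γ)

/-- The matrix `A`, with row degrees `α`, over the graded division ring `K` has rank `r`: the right
`K`-module spanned by its columns has dimension `r`. -/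
def HasGradedRank (𝒦 : Γ → AddSubgroup K) {m n : ℕ} (α : Fin m → Γ)
    (A : Matrix (Fin m) (Fin n) K) (r : ℕ) : Prop :=
  HasGradedDim 𝒦 α (Submodule.span Kᵐᵒᵖ (Set.range A.col)) r

end GradedDivisionRings

/-! From ideal to rank, the rank of a matrix is the size of its largest minor outside `P`. The
Sylvester axioms then follow from determinant-like rules for `P`. Matrices with a large zero block
or a dependent column are not gr-full, so they lie in `P`. Determinantal sums expand a matrix column
by column into such matrices and a few others. Hence block triangular matrices behave like diagonal
ones, adding multiples of columns to other columns preserves membership, and `mem_mul_of_minors`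
plays the role of Cauchy-Binet: if `A * B` is outside `P`, then so are complementary maximal minors
of `A` and `B`. This last fact gives the product axiom.

From rank to ideal, axiom (4) makes the rank submodular in the set of columns (and of rows) that are
kept. Submodularity bounds the rank of a determinantal sum (`rank_updateCol_lt`,
`rank_updateRow_lt`). By a matroid basis argument it also yields, in a matrix of rank `r`, an `r ×
r` minor of rank `r` (`exists_minor_rank_eq`). So the rank is recovered from its ideal; conversely,
the only `n × n` minors of an `n × n` matrix are its row and column permutations, so the ideal is
recovered from its rank.

Over a graded division ring, the Schur complement of a largest invertible minor of a homogeneous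
matrix has homogeneous entries. A nonzero one would be a unit and would enlarge the minor. So the
columns of the minor form a homogeneous basis of the column space. If `P` is the gr-singular kernel,
the invertible minors are exactly those outside `P`. -/

/-! ### Homogeneous matrices with arbitrary index types. -/

section GradedMatrices

variable {Γ : Type*} [AddGroup Γ] {R : Type*} [Ring R] {𝒜 : Γ → AddSubgroup R}
variable {ι κ ι' κ' τ : Type*}

/-- The analogue of `HasDistribution` for matrices with arbitrary index types. -/
def HasDegrees (𝒜 : Γ → AddSubgroup R) (M : Matrix ι κ R) (α : ι → Γ) (β : κ → Γ) : Prop :=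
  ∀ i j, M i j ∈ 𝒜 (α i - β j)

namespace HasDegrees

theorem submatrix {M : Matrix ι κ R} {α : ι → Γ} {β : κ → Γ} (hM : HasDegrees 𝒜 M α β)
    (f : ι' → ι) (g : κ' → κ) : HasDegrees 𝒜 (M.submatrix f g) (α ∘ f) (β ∘ g) :=
  fun i j => hM (f i) (g j)

theorem isHomogeneousMatrix {m n : ℕ} {M : Matrix ι κ R} {α : ι → Γ} {β : κ → Γ}
    (hM : HasDegrees 𝒜 M α β) (f : Fin m → ι) (g : Fin n → κ) :
    IsHomogeneousMatrix 𝒜 (M.submatrix f g) :=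
  ⟨_, _, hM.submatrix f g⟩

theorem zero (α : ι → Γ) (β : κ → Γ) : HasDegrees 𝒜 (0 : Matrix ι κ R) α β :=
  fun _ _ => (𝒜 _).zero_mem

theorem neg {M : Matrix ι κ R} {α : ι → Γ} {β : κ → Γ} (hM : HasDegrees 𝒜 M α β) :
    HasDegrees 𝒜 (-M) α β :=
  fun i j => (𝒜 _).neg_mem (hM i j)

theorem add {M N : Matrix ι κ R} {α : ι → Γ} {β : κ → Γ} (hM : HasDegrees 𝒜 M α β)
    (hN : HasDegrees 𝒜 N α β) : HasDegrees 𝒜 (M + N) α β :=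
  fun i j => (𝒜 _).add_mem (hM i j) (hN i j)

theorem sub {M N : Matrix ι κ R} {α : ι → Γ} {β : κ → Γ} (hM : HasDegrees 𝒜 M α β)
    (hN : HasDegrees 𝒜 N α β) : HasDegrees 𝒜 (M - N) α β :=
  fun i j => (𝒜 _).sub_mem (hM i j) (hN i j)

theorem fromBlocks {A : Matrix ι κ R} {B : Matrix ι κ' R} {C : Matrix ι' κ R}
    {D : Matrix ι' κ' R} {α : ι → Γ} {β : κ → Γ} {δ : ι' → Γ} {ε : κ' → Γ}
    (hA : HasDegrees 𝒜 A α β) (hB : HasDegrees 𝒜 B α ε) (hC : HasDegrees 𝒜 C δ β)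
    (hD : HasDegrees 𝒜 D δ ε) :
    HasDegrees 𝒜 (Matrix.fromBlocks A B C D) (Sum.elim α δ) (Sum.elim β ε) := by
  rintro (i | i) (j | j)
  exacts [hA i j, hB i j, hC i j, hD i j]

theorem fromCols {A : Matrix ι κ R} {B : Matrix ι κ' R} {α : ι → Γ} {β : κ → Γ} {ε : κ' → Γ}
    (hA : HasDegrees 𝒜 A α β) (hB : HasDegrees 𝒜 B α ε) :
    HasDegrees 𝒜 (Matrix.fromCols A B) α (Sum.elim β ε) := by
  rintro i (j | j)
  exacts [hA i j, hB i j]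

theorem ite {p : ι → κ → Prop} [∀ i j, Decidable (p i j)] {M N : Matrix ι κ R} {α : ι → Γ}
    {β : κ → Γ} (hM : HasDegrees 𝒜 M α β) (hN : HasDegrees 𝒜 N α β) :
    HasDegrees 𝒜 (Matrix.of fun i j => if p i j then M i j else N i j) α β := by
  intro i j
  rw [Matrix.of_apply]
  split_ifs
  exacts [hM i j, hN i j]

theorem map {R' : Type*} [Ring R'] {𝒜' : Γ → AddSubgroup R'} {M : Matrix ι κ R} {α : ι → Γ}
    {β : κ → Γ} (hM : HasDegrees 𝒜 M α β) (φ : 𝒜 →+*ᵍ 𝒜') : HasDegrees 𝒜' (M.map φ) α β :=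
  fun i j => φ.map_mem (hM i j)

variable [SetLike.GradedMonoid 𝒜]

theorem one [DecidableEq ι] (α : ι → Γ) : HasDegrees 𝒜 (1 : Matrix ι ι R) α α := by
  intro i j
  rw [Matrix.one_apply]
  split_ifs with h
  · rw [h, sub_self]
    exact SetLike.GradedOne.one_mem
  · exact (𝒜 _).zero_mem

theorem mul [Fintype κ] {M : Matrix ι κ R} {N : Matrix κ τ R} {α : ι → Γ} {β : κ → Γ}
    {ε : τ → Γ} (hM : HasDegrees 𝒜 M α β) (hN : HasDegrees 𝒜 N β ε) :
    HasDegrees 𝒜 (M * N) α ε := by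
  intro i j
  rw [Matrix.mul_apply]
  refine sum_mem fun k _ => ?_
  have h := SetLike.mul_mem_graded (hM i k) (hN k j)
  rwa [sub_add_sub_cancel] at h

theorem diagonal_ite [DecidableEq ι] (p : ι → Prop) [DecidablePred p] (α : ι → Γ) :
    HasDegrees 𝒜 (Matrix.diagonal fun i => if p i then (1 : R) else 0) α α := by
  intro i j
  rw [Matrix.diagonal_apply]
  split_ifs with h h'
  · rw [h, sub_self]
    exact SetLike.GradedOne.one_mem
  all_goals exact (𝒜 _).zero_mem

end HasDegrees

end GradedMatrices

/-! ### Matrices forced into a gr-prime matrix ideal, and column expansion. -/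

namespace GrPrimeMatrixIdeal

variable {Γ : Type*} [AddGroup Γ] {R : Type*} [Ring R] {𝒜 : Γ → AddSubgroup R}
variable (P : GrPrimeMatrixIdeal 𝒜)
variable {ι κ ι' κ' ι₁ ι₂ κ₁ κ₂ τ : Type*} [Fintype ι] [Fintype κ] [Fintype ι'] [Fintype κ']
  [Fintype ι₁] [Fintype ι₂] [Fintype κ₁] [Fintype κ₂] [Fintype τ]

/-- A matrix whose rows and columns are indexed by arbitrary finite types belongs to `P` if some
(equivalently, every) enumeration of its rows and columns gives an element of `P`. -/
def Mem {ι κ : Type*} (M : Matrix ι κ R) : Prop :=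
  ∃ (n : ℕ) (e : Fin n ≃ ι) (f : Fin n ≃ κ), M.submatrix e f ∈ P.carrier n

variable {P}

theorem submatrix_perm_mem {n : ℕ} {A : Matrix (Fin n) (Fin n) R} (hA : A ∈ P.carrier n)
    (σ τ : Equiv.Perm (Fin n)) : A.submatrix σ τ ∈ P.carrier n := by
  -- Right multiplication by a permutation matrix permutes the columns by the inverse permutation.
  have h := P.perm_mem σ τ.symm hA
  rw [Equiv.Perm.permMatrix, Equiv.Perm.permMatrix, PEquiv.toMatrix_toPEquiv_mul,
    PEquiv.mul_toMatrix_toPEquiv, Matrix.submatrix_submatrix] at h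
  exact h

theorem mem_iff_submatrix_mem {ι κ : Type*} {n : ℕ} {M : Matrix ι κ R} (e : Fin n ≃ ι)
    (f : Fin n ≃ κ) : P.Mem M ↔ M.submatrix e f ∈ P.carrier n := by
  refine ⟨?_, fun h => ⟨n, e, f, h⟩⟩
  rintro ⟨m, e', f', h⟩
  obtain rfl : m = n := by simpa using Fintype.card_congr (e'.trans e.symm)
  have := submatrix_perm_mem h (e.trans e'.symm) (f.trans f'.symm)
  rw [Matrix.submatrix_submatrix] at this
  convert this using 2 <;> ext <;> simp

theorem mem_fin_iff {n : ℕ} {A : Matrix (Fin n) (Fin n) R} : P.Mem A ↔ A ∈ P.carrier n :=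
  mem_iff_submatrix_mem (Equiv.refl _) (Equiv.refl _)

theorem mem_submatrix_equiv_iff {ι κ ι' κ' : Type*} {M : Matrix ι κ R} (e : ι' ≃ ι)
    (f : κ' ≃ κ) : P.Mem (M.submatrix e f) ↔ P.Mem M := by
  constructor
  · rintro ⟨n, e', f', h⟩
    exact ⟨n, e'.trans e, f'.trans f, h⟩
  · rintro ⟨n, e', f', h⟩
    refine ⟨n, e'.trans e.symm, f'.trans f.symm, ?_⟩
    convert h using 1
    ext
    simp

theorem mem_mul_of_card_lt {A : Matrix ι τ R} {B : Matrix τ κ R} {α : ι → Γ} {ν : τ → Γ}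
    {β : κ → Γ} [SetLike.GradedMonoid 𝒜] (hA : HasDegrees 𝒜 A α ν) (hB : HasDegrees 𝒜 B ν β)
    (hιτ : Fintype.card τ < Fintype.card ι) (hικ : Fintype.card ι = Fintype.card κ) :
    P.Mem (A * B) := by
  let e := (Fintype.equivFin ι).symm
  let f := (Fintype.equivFinOfCardEq hικ.symm).symm
  let g := (Fintype.equivFin τ).symm
  rw [mem_iff_submatrix_mem e f]
  refine P.not_grFull_mem ((hA.mul hB).isHomogeneousMatrix e f) fun h => ?_
  have := h _ _ _ _ (A.submatrix e g) (B.submatrix g f) (hA.submatrix e g) (hB.submatrix g f)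
    (by rw [Matrix.submatrix_mul_equiv])
  omega

/-- A matrix with a large block of zeros belongs to `P`. -/
theorem mem_of_zero_block {M : Matrix ι κ R} {α : ι → Γ} {β : κ → Γ} [SetLike.GradedMonoid 𝒜]
    (hM : HasDegrees 𝒜 M α β) (p : ι → Prop) (q : κ → Prop) (hpq : ∀ i j, p i → q j → M i j = 0)
    (hcard : Nat.card {i // ¬ p i} + Nat.card {j // ¬ q j} < Fintype.card ι)
    (hικ : Fintype.card ι = Fintype.card κ) : P.Mem M := by
  classical
  simp only [Nat.card_eq_fintype_card] at hcard
  -- Rows outside `p` are copied from `M`; rows in `p` are supported on the columns outside `q`. So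
  -- `M` factors through an index set with one element for each such row and each such column.
  let A : Matrix ι ({i // ¬ p i} ⊕ {j // ¬ q j}) R :=
    Matrix.fromCols ((1 : Matrix ι ι R).submatrix id Subtype.val)
      (Matrix.of fun i j => if p i then M i j else 0)
  let B : Matrix ({i // ¬ p i} ⊕ {j // ¬ q j}) κ R :=
    Matrix.fromRows (M.submatrix Subtype.val id) ((1 : Matrix κ κ R).submatrix Subtype.val id)
  have hA : HasDegrees 𝒜 A α (Sum.elim (α ∘ Subtype.val) (β ∘ Subtype.val)) :=
    ((HasDegrees.one α).submatrix id _).fromCols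
      (HasDegrees.ite (hM.submatrix id Subtype.val) (HasDegrees.zero _ _))
  have hB : HasDegrees 𝒜 B (Sum.elim (α ∘ Subtype.val) (β ∘ Subtype.val)) β := by
    rintro (i | i) j
    exacts [hM i j, HasDegrees.one β i j]
  have hAB : M = A * B := by
    ext i j
    rw [Matrix.fromCols_mul_fromRows, Matrix.add_apply, Matrix.mul_apply, Matrix.mul_apply]
    by_cases hi : p i
    · rw [Finset.sum_eq_zero, zero_add]
      · by_cases hj : q j
        · rw [hpq i j hi hj, Finset.sum_eq_zero]
          rintro ⟨x, hx⟩ -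
          have : x ≠ j := fun h => hx (h ▸ hj)
          simp [this]
        · rw [Finset.sum_eq_single ⟨j, hj⟩]
          · simp [hi, Matrix.one_apply]
          · rintro ⟨x, hx⟩ - hxj
            have : x ≠ j := fun h => hxj (Subtype.ext h)
            simp [this]
          · simp
      · rintro ⟨x, hx⟩ -
        have : i ≠ x := fun h => hx (h ▸ hi)
        simp [this]
    · rw [Finset.sum_eq_single ⟨i, hi⟩]
      · simp [hi, Matrix.one_apply]
      · rintro ⟨x, hx⟩ - hxi
        have : i ≠ x := fun h => hxi (Subtype.ext h.symm)
        simp [this]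
      · simp
  rw [hAB]
  exact mem_mul_of_card_lt hA hB (by simpa using hcard) hικ

/-- A matrix with a column that is a combination of the other ones belongs to `P`. -/
theorem mem_of_col_eq {M : Matrix ι κ R} {α : ι → Γ} {β : κ → Γ} [SetLike.GradedMonoid 𝒜]
    (hM : HasDegrees 𝒜 M α β) (k : κ) (c : κ → R) (hc : ∀ j, c j ∈ 𝒜 (β j - β k)) (hk : c k = 0)
    (h : ∀ i, M i k = ∑ j, M i j * c j) (hικ : Fintype.card ι = Fintype.card κ) : P.Mem M := by
  classical
  -- `B` rebuilds `M` from the columns other than `k`, so `M` factors through one index fewer than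
  -- its size.
  let B : Matrix {j // j ≠ k} κ R :=
    Matrix.of fun x j => if j = k then c x else if x = j then 1 else 0
  have hB : HasDegrees 𝒜 B (β ∘ Subtype.val) β := by
    intro x j
    simp only [B, Matrix.of_apply]
    split_ifs with h₁ h₂
    · rw [h₁]; exact hc x
    · rw [← h₂, Function.comp_apply, sub_self]; exact SetLike.GradedOne.one_mem
    · exact (𝒜 _).zero_mem
  have hMB : M = M.submatrix id Subtype.val * B := by
    ext i j
    change M i j = ∑ x : {j // j ≠ k}, M i x * B x j
    by_cases hj : j = k
    · subst hj
      rw [h, ← Finset.add_sum_erase _ _ (Finset.mem_univ j), hk, mul_zero, zero_add]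
      rw [Finset.sum_subtype (F := inferInstance) (p := fun x => x ≠ j) _ (by simp)]
      simp [B]
    · rw [Finset.sum_eq_single ⟨j, hj⟩]
      · simp [B, hj]
      · rintro ⟨x, hx⟩ - hxj
        have : x ≠ j := fun h => hxj (Subtype.ext h)
        simp [B, hj, this]
      · simp
  have hcard : Fintype.card {j // j ≠ k} < Fintype.card ι :=
    hικ ▸ Fintype.card_subtype_lt (x := k) (by simp)
  rw [hMB]
  exact mem_mul_of_card_lt (hM.submatrix id Subtype.val) hB hcard hικ

theorem mem_of_col_sum {ι κ : Type*} {L M N : Matrix ι κ R} {α : ι → Γ} {β : κ → Γ} (k : κ)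
    (hM : HasDegrees 𝒜 M α β) (hN : HasDegrees 𝒜 N α β) (hPM : P.Mem M) (hPN : P.Mem N)
    (hMN : ∀ i j, j ≠ k → M i j = N i j) (hLM : ∀ i j, j ≠ k → L i j = M i j)
    (hL : ∀ i, L i k = M i k + N i k) : P.Mem L := by
  obtain ⟨n, e, f, h⟩ := hPM
  rw [mem_iff_submatrix_mem e f] at hPN ⊢
  have := P.col_sum_mem (f.symm k) (hM.submatrix e f) (hN.submatrix e f)
    (fun i j hj => hMN _ _ fun h => hj (by simp [← h])) h hPN
  convert this using 1
  ext i j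
  by_cases hj : j = f.symm k
  · subst hj
    simp [hL]
  · rw [Matrix.updateCol_ne hj]
    exact hLM _ _ fun h => hj (by simp [← h])

/-- Expansion of a matrix along the columns in `s`. -/
theorem mem_of_forall_subset {ι κ : Type*} [DecidableEq κ] {Y Z : Matrix ι κ R} {α : ι → Γ}
    {β : κ → Γ}
    (hY : HasDegrees 𝒜 Y α β) (hZ : HasDegrees 𝒜 Z α β) (s : Finset κ)
    (h : ∀ t ⊆ s, P.Mem (Matrix.of fun i j => if j ∈ t then Z i j else Y i j)) :
    P.Mem (Matrix.of fun i j => if j ∈ s then Y i j + Z i j else Y i j) := by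
  induction s using Finset.induction generalizing Y with
  | empty => simpa using h ∅ subset_rfl
  | insert k s hk ih =>
    -- The column `k` is split first: the induction hypothesis is used for `Y` and for `Y` with its
    -- column `k` taken from `Z`, which is why `Y` is generalized.
    have hY' : HasDegrees 𝒜 (Matrix.of fun i j => if j = k then Z i j else Y i j) α β :=
      HasDegrees.ite hZ hY
    have h₁ := ih hY fun t ht => h t (ht.trans (Finset.subset_insert _ _))
    have h₂ := ih hY' fun t ht => by
      convert h (insert k t) (Finset.insert_subset_insert _ ht) using 1
      ext i j
      by_cases hj : j = k <;> simp [hj]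
    refine mem_of_col_sum k (HasDegrees.ite (hY.add hZ) hY) (HasDegrees.ite (hY'.add hZ) hY')
      h₁ h₂ ?_ ?_ ?_
    · intro i j hj
      simp [hj]
    · intro i j hj
      simp [hj]
    · intro i
      simp [hk]

/-- This form serves the block arguments below, where most of the hybrids of `Y` and `Z` have a
large zero block or a dependent column and so are not gr-full. -/
theorem mem_add_of_forall {ι κ : Type*} [DecidableEq κ] {Y Z : Matrix ι κ R} {α : ι → Γ}
    {β : κ → Γ}
    (hY : HasDegrees 𝒜 Y α β) (hZ : HasDegrees 𝒜 Z α β) (s : Finset κ)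
    (hs : ∀ i, ∀ j ∉ s, Z i j = 0)
    (h : ∀ t ⊆ s, P.Mem (Matrix.of fun i j => if j ∈ t then Z i j else Y i j)) :
    P.Mem (Y + Z) := by
  convert mem_of_forall_subset hY hZ s h using 1
  ext i j
  by_cases hj : j ∈ s <;> simp [hj, hs]

theorem mem_fromBlocks_diagonal_iff {A : Matrix ι₁ κ₁ R} {B : Matrix ι₂ κ₂ R}
    {α : ι₁ → Γ} {β : κ₁ → Γ} {δ : ι₂ → Γ} {ε : κ₂ → Γ}
    (hA : HasDegrees 𝒜 A α β) (hB : HasDegrees 𝒜 B δ ε)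
    (h₁ : Fintype.card ι₁ = Fintype.card κ₁) (h₂ : Fintype.card ι₂ = Fintype.card κ₂) :
    P.Mem (Matrix.fromBlocks A 0 0 B) ↔ P.Mem A ∨ P.Mem B := by
  let e₁ := (Fintype.equivFin ι₁).symm
  let f₁ := (Fintype.equivFinOfCardEq h₁.symm).symm
  let e₂ := (Fintype.equivFin ι₂).symm
  let f₂ := (Fintype.equivFinOfCardEq h₂.symm).symm
  -- Axiom (PM3) appends a block after the element of `P` only; a permutation puts it in front.
  have key : ∀ {m n : ℕ} {X : Matrix (Fin m) (Fin m) R} {Y : Matrix (Fin n) (Fin n) R},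
      X ∈ P.carrier m → IsHomogeneousMatrix 𝒜 Y → diagSum Y X ∈ P.carrier (n + m) := by
    intro m n X Y hX hY
    have := P.diagSum_mem hX hY
    rw [diagSum, upperBlock, Matrix.reindex_apply, ← mem_fin_iff, mem_submatrix_equiv_iff] at this ⊢
    rw [← mem_submatrix_equiv_iff (Equiv.sumComm _ _) (Equiv.sumComm _ _)] at this
    convert this using 1
    ext (i | i) (j | j) <;> simp
  rw [mem_iff_submatrix_mem e₁ f₁, mem_iff_submatrix_mem e₂ f₂,
    mem_iff_submatrix_mem (finSumFinEquiv.symm.trans (Equiv.sumCongr e₁ e₂))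
      (finSumFinEquiv.symm.trans (Equiv.sumCongr f₁ f₂))]
  have : (Matrix.fromBlocks A 0 0 B).submatrix (finSumFinEquiv.symm.trans (Equiv.sumCongr e₁ e₂))
      (finSumFinEquiv.symm.trans (Equiv.sumCongr f₁ f₂)) =
      diagSum (A.submatrix e₁ f₁) (B.submatrix e₂ f₂) := by
    ext i j
    rw [diagSum, upperBlock, Matrix.reindex_apply, Matrix.submatrix_apply, Matrix.submatrix_apply,
      Equiv.trans_apply, Equiv.trans_apply]
    rcases finSumFinEquiv.symm i with i | i <;> rcases finSumFinEquiv.symm j with j | j <;> simp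
  rw [this]
  constructor
  · exact P.mem_or_mem (hA.isHomogeneousMatrix _ _) (hB.isHomogeneousMatrix _ _)
  · rintro (h | h)
    · exact P.diagSum_mem h (hB.isHomogeneousMatrix _ _)
    · exact key h (hA.isHomogeneousMatrix _ _)

end GrPrimeMatrixIdeal

/-! ### Block triangular matrices, column operations and a Cauchy-Binet principle. -/

namespace GrPrimeMatrixIdeal

variable {Γ : Type*} [AddGroup Γ] {R : Type*} [Ring R] {𝒜 : Γ → AddSubgroup R}
  [SetLike.GradedMonoid 𝒜] {P : GrPrimeMatrixIdeal 𝒜}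
variable {ι κ ι₁ ι₂ κ₁ κ₂ τ : Type*} [Fintype ι] [Fintype κ]
  [Fintype ι₁] [Fintype ι₂] [Fintype κ₁] [Fintype κ₂] [Fintype τ]

/-- Expand along the columns of the second block. A term that takes a column from `D` has zeros
below it, so the rows `ι₂` meet the columns `κ₁` and that column in a zero block one column too wide
for a full matrix. -/
theorem mem_fromBlocks_upper_add {A : Matrix ι₁ κ₁ R} {B : Matrix ι₂ κ₂ R}
    {C D : Matrix ι₁ κ₂ R} {α : ι₁ → Γ} {β : κ₁ → Γ} {δ : ι₂ → Γ} {ε : κ₂ → Γ}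
    (hA : HasDegrees 𝒜 A α β) (hB : HasDegrees 𝒜 B δ ε) (hC : HasDegrees 𝒜 C α ε)
    (hD : HasDegrees 𝒜 D α ε) (h₁ : Fintype.card ι₁ = Fintype.card κ₁)
    (h₂ : Fintype.card ι₂ = Fintype.card κ₂) (h : P.Mem (Matrix.fromBlocks A C 0 B)) :
    P.Mem (Matrix.fromBlocks A (C + D) 0 B) := by
  classical
  have hY := hA.fromBlocks hC (.zero δ β) hB
  have hZ : HasDegrees 𝒜 (Matrix.fromBlocks 0 D 0 0) (Sum.elim α δ) (Sum.elim β ε) :=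
    (HasDegrees.zero _ _).fromBlocks hD (.zero _ _) (.zero _ _)
  have := mem_add_of_forall (P := P) hY hZ (Finset.univ.map .inr) ?_ ?_
  · simpa [Matrix.fromBlocks_add] using this
  · rintro (i | i) (j | j) hj <;> simp_all
  · intro t ht
    obtain rfl | ⟨k, hk⟩ := t.eq_empty_or_nonempty
    · convert h using 1
      ext
      simp
    · obtain ⟨k, rfl⟩ : ∃ k', Sum.inr k' = k := by simpa using ht hk
      refine mem_of_zero_block (HasDegrees.ite hZ hY) (fun i => i.isRight)
        (fun j => j.isLeft ∨ j = Sum.inr k) ?_ ?_ (by simp [h₁, h₂])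
      · rintro (i | i) (j | j) hi hj
        all_goals simp at hi hj
        · simp
        · simp [hj, hk]
      · have e₁ : Nat.card {i : ι₁ ⊕ ι₂ // ¬ i.isRight} ≤ Nat.card ι₁ := by
          refine Nat.card_le_card_of_surjective (fun i : ι₁ => ⟨Sum.inl i, by simp⟩) ?_
          rintro ⟨i | i, hi⟩
          · exact ⟨i, rfl⟩
          · simp at hi
        have e₂ : Nat.card {j : κ₁ ⊕ κ₂ // ¬ (j.isLeft ∨ j = Sum.inr k)} ≤
            Nat.card {j : κ₂ // j ≠ k} := by
          refine Nat.card_le_card_of_surjective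
            (fun j : {j : κ₂ // j ≠ k} => ⟨Sum.inr j, by simp [j.2]⟩) ?_
          rintro ⟨j | j, hj⟩
          · simp at hj
          · exact ⟨⟨j, by simpa using hj⟩, rfl⟩
        have e₃ : Fintype.card {j : κ₂ // j ≠ k} < Fintype.card κ₂ :=
          Fintype.card_subtype_lt (x := k) (by simp)
        simp only [Nat.card_eq_fintype_card, Fintype.card_sum] at e₁ e₂ ⊢
        omega

theorem mem_fromBlocks_upper_iff {A : Matrix ι₁ κ₁ R} {B : Matrix ι₂ κ₂ R}
    {C : Matrix ι₁ κ₂ R} {α : ι₁ → Γ} {β : κ₁ → Γ} {δ : ι₂ → Γ} {ε : κ₂ → Γ}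
    (hA : HasDegrees 𝒜 A α β) (hB : HasDegrees 𝒜 B δ ε) (hC : HasDegrees 𝒜 C α ε)
    (h₁ : Fintype.card ι₁ = Fintype.card κ₁) (h₂ : Fintype.card ι₂ = Fintype.card κ₂) :
    P.Mem (Matrix.fromBlocks A C 0 B) ↔ P.Mem A ∨ P.Mem B := by
  rw [← mem_fromBlocks_diagonal_iff hA hB h₁ h₂]
  constructor <;> intro h
  · simpa using mem_fromBlocks_upper_add hA hB hC hC.neg h₁ h₂ h
  · simpa using mem_fromBlocks_upper_add hA hB (.zero _ _) hC h₁ h₂ h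

/-- In the expansion, every term that uses a column of `X * T` has that column dependent on those of
`X`. -/
theorem mem_fromCols_add_mul {X : Matrix ι κ₁ R} {Y : Matrix ι κ₂ R} {T : Matrix κ₁ κ₂ R}
    {α : ι → Γ} {β : κ₁ → Γ} {ε : κ₂ → Γ} (hX : HasDegrees 𝒜 X α β)
    (hY : HasDegrees 𝒜 Y α ε) (hT : HasDegrees 𝒜 T β ε)
    (hcard : Fintype.card ι = Fintype.card κ₁ + Fintype.card κ₂)
    (h : P.Mem (Matrix.fromCols X Y)) : P.Mem (Matrix.fromCols X (Y + X * T)) := by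
  classical
  have hZ := (HasDegrees.zero (𝒜 := 𝒜) α β).fromCols (hX.mul hT)
  have := mem_add_of_forall (P := P) (hX.fromCols hY) hZ (Finset.univ.map .inr) ?_ ?_
  · convert this using 1
    ext i (j | j) <;> simp
  · rintro i (j | j) hj <;> simp_all
  · intro t ht
    obtain rfl | ⟨k, hk⟩ := t.eq_empty_or_nonempty
    · convert h using 1
      ext
      simp
    · obtain ⟨k, rfl⟩ : ∃ k', Sum.inr k' = k := by simpa using ht hk
      have hl : ∀ j, Sum.inl j ∉ t := fun j hj => by simpa using ht hj
      refine mem_of_col_eq (HasDegrees.ite hZ (hX.fromCols hY)) (Sum.inr k)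
        (Sum.elim (fun j => T j k) 0) ?_ rfl ?_ (by simpa using hcard)
      · rintro (j | j)
        exacts [hT j k, (𝒜 _).zero_mem]
      · intro i
        simp [hk, hl, Matrix.mul_apply]

theorem not_mem_one_fin (n : ℕ) : ¬ P.Mem (1 : Matrix (Fin n) (Fin n) R) := by
  have h₁ := P.one_notMem
  rw [← mem_fin_iff] at h₁
  induction n with
  | zero =>
    -- If the empty matrix were in `P`, its diagonal sum with `(1)`, which is `(1)`, would be too.
    intro h
    have h₂ := (mem_fromBlocks_diagonal_iff (P := P) (HasDegrees.one (𝒜 := 𝒜) (0 : Fin 0 → Γ))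
      (HasDegrees.one (0 : Fin 1 → Γ)) rfl rfl).2 (Or.inl h)
    rw [Matrix.fromBlocks_one, ← mem_submatrix_equiv_iff (Equiv.emptySum _ _).symm
      (Equiv.emptySum _ _).symm, Matrix.submatrix_one_equiv] at h₂
    exact h₁ h₂
  | succ n ih =>
    intro h
    rw [← mem_submatrix_equiv_iff finSumFinEquiv finSumFinEquiv, Matrix.submatrix_one_equiv,
      ← Matrix.fromBlocks_one, mem_fromBlocks_diagonal_iff (HasDegrees.one 0) (HasDegrees.one 0)
      rfl rfl] at h
    exact h.elim ih h₁

theorem not_mem_one [DecidableEq ι] : ¬ P.Mem (1 : Matrix ι ι R) := by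
  rw [← mem_submatrix_equiv_iff (Fintype.equivFin ι).symm (Fintype.equivFin ι).symm,
    Matrix.submatrix_one_equiv]
  exact not_mem_one_fin _

/-- The matrix with rows `(1, B)` and `(A, 0)` is expanded along its first block of columns. In the
term of `s`, the columns in `s` come from `A` and the others from the identity. Unless `s` has as
many elements as `ι`, there is too large a zero block; otherwise the term is, up to permutation,
built from the minors of `A` and `B` at `s`. Clearing `B` by column operations leaves `-(A * B)` in
the corner. -/
theorem mem_neg_mul_of_minors [DecidableEq τ] {A : Matrix ι τ R} {B : Matrix τ κ R}
    {α : ι → Γ} {ν : τ → Γ} {β : κ → Γ}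
    (hA : HasDegrees 𝒜 A α ν) (hB : HasDegrees 𝒜 B ν β) (hικ : Fintype.card ι = Fintype.card κ)
    (h : ∀ s : Finset τ, s.card = Fintype.card ι →
      P.Mem (A.submatrix id (Subtype.val : {x // x ∈ s} → τ)) ∨
        P.Mem (B.submatrix (Subtype.val : {x // x ∈ s} → τ) id)) : P.Mem (-(A * B)) := by
  classical
  have hY : HasDegrees 𝒜 (Matrix.fromBlocks 1 B (0 : Matrix ι τ R) 0) (Sum.elim ν α)
      (Sum.elim ν β) := (HasDegrees.one ν).fromBlocks hB (.zero _ _) (.zero _ _)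
  have hZ : HasDegrees 𝒜 (Matrix.fromBlocks 0 0 A 0) (Sum.elim ν α) (Sum.elim ν β) :=
    (HasDegrees.zero _ _).fromBlocks (.zero _ _) hA (.zero _ _)
  have hN := mem_add_of_forall (P := P) hY hZ (Finset.univ.map .inl) ?_ ?_
  · rw [Matrix.fromBlocks_add, zero_add, add_zero, add_zero, add_zero,
      ← Matrix.fromCols_fromRows_eq_fromBlocks] at hN
    have := mem_fromCols_add_mul (T := -B) (α := Sum.elim ν α) (β := ν) (ε := β)
      (by rintro (i | i) j; exacts [HasDegrees.one ν i j, hA i j])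
      (by rintro (i | i) j; exacts [hB i j, (𝒜 _).zero_mem]) hB.neg (by simp [hικ, add_comm]) hN
    rw [← mem_submatrix_equiv_iff (Equiv.sumComm _ _) (Equiv.sumComm _ _)] at this
    refine ((mem_fromBlocks_upper_iff (B := (1 : Matrix τ τ R)) (C := A) (hA.mul hB).neg
      (HasDegrees.one ν) hA hικ rfl).1 ?_).resolve_right not_mem_one
    convert this using 1
    ext (i | i) (j | j) <;> simp [Matrix.fromRows_mul]
  · rintro (i | i) (j | j) hj <;> simp_all
  · intro t ht
    obtain ⟨s, rfl⟩ : ∃ s : Finset τ, t = s.map .inl := by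
      refine ⟨t.preimage Sum.inl Sum.inl_injective.injOn, ?_⟩
      ext j
      constructor
      · intro hj
        obtain ⟨k, rfl⟩ : ∃ k, Sum.inl k = j := by simpa using ht hj
        simpa using hj
      · simp only [Finset.mem_map, Finset.mem_preimage]
        rintro ⟨k, hk, rfl⟩
        exact hk
    have hM := HasDegrees.ite (p := fun _ j => j ∈ s.map .inl) hZ hY
    obtain hlt | heq | hgt := lt_trichotomy s.card (Fintype.card ι)
    · refine mem_of_zero_block hM (fun i => i.isRight) (fun j => j ∉ s.map .inl) ?_ ?_
        (by simp [hικ, add_comm])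
      · rintro (i | i) (j | j) hi hj
        all_goals simp at hi hj
        all_goals simp [hj]
      · have e₁ : Nat.card {i : τ ⊕ ι // ¬ i.isRight} ≤ Nat.card τ := by
          refine Nat.card_le_card_of_surjective (fun i : τ => ⟨Sum.inl i, by simp⟩) ?_
          rintro ⟨i | i, hi⟩
          · exact ⟨i, rfl⟩
          · simp at hi
        have e₂ : Nat.card {j : τ ⊕ κ // ¬ j ∉ s.map .inl} = s.card := by
          simp only [not_not, Nat.card_eq_fintype_card, Fintype.card_coe, Finset.card_map]
        simp only [Nat.card_eq_fintype_card, Fintype.card_sum] at e₁ e₂ ⊢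
        omega
    -- Reordered, the term is the diagonal sum of a block triangular matrix, with diagonal blocks
    -- `1` and the rows `s` of `B`, and the columns `s` of `A`.
    · let e := (Equiv.sumCompl fun x => x ∈ s)
      let er : ({x // x ∉ s} ⊕ {x // x ∈ s}) ⊕ ι ≃ τ ⊕ ι :=
        Equiv.sumCongr ((Equiv.sumComm _ _).trans e) (Equiv.refl ι)
      let ec : ({x // x ∉ s} ⊕ κ) ⊕ {x // x ∈ s} ≃ τ ⊕ κ :=
        ((Equiv.sumAssoc _ _ _).trans (Equiv.sumCongr (Equiv.refl _) (Equiv.sumComm _ _))).trans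
          ((Equiv.sumAssoc _ _ _).symm.trans
            (Equiv.sumCongr ((Equiv.sumComm _ _).trans e) (Equiv.refl κ)))
      rw [← mem_submatrix_equiv_iff er ec]
      have hc₁ : Fintype.card {x // x ∈ s} = Fintype.card κ := by simp [heq, hικ]
      have hc₂ : Fintype.card ι = Fintype.card {x // x ∈ s} := by simp [heq]
      have hB₁ := hB.submatrix (Subtype.val : {x // x ∉ s} → τ) id
      have hB₂ := hB.submatrix (Subtype.val : {x // x ∈ s} → τ) id
      have hA₁ := hA.submatrix id (Subtype.val : {x // x ∈ s} → τ)
      have hone := HasDegrees.one (𝒜 := 𝒜) (ν ∘ (Subtype.val : {x // x ∉ s} → τ))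
      have := (mem_fromBlocks_diagonal_iff (P := P)
        (hone.fromBlocks hB₁ (.zero _ _) hB₂) hA₁ (by simp [heq, hικ]) hc₂).2 ?_
      · convert this using 1
        ext ((⟨i, hi⟩ | ⟨i, hi⟩) | i) ((⟨j, hj⟩ | j) | ⟨j, hj⟩)
        all_goals first
          | simp [er, ec, e, hj, Matrix.one_apply]
          | simp [er, ec, e]
        rintro rfl
        exact absurd hi hj
      · rw [mem_fromBlocks_upper_iff hone hB₂ hB₁ rfl hc₁]
        exact (h s heq).symm.imp Or.inr id
    · refine mem_of_zero_block hM (fun i => i.isLeft) (fun j => j ∈ s.map .inl) ?_ ?_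
        (by simp [hικ, add_comm])
      · rintro (i | i) (j | j) hi hj
        all_goals simp at hi hj
        simp [hj]
      · have e₁ : Nat.card {i : τ ⊕ ι // ¬ i.isLeft} ≤ Nat.card ι := by
          refine Nat.card_le_card_of_surjective (fun i : ι => ⟨Sum.inr i, by simp⟩) ?_
          rintro ⟨i | i, hi⟩
          · simp at hi
          · exact ⟨i, rfl⟩
        have e₂ : Nat.card {j : τ ⊕ κ // j ∉ s.map .inl} =
            Fintype.card τ + Fintype.card κ - s.card := by
          rw [Nat.card_eq_fintype_card, Fintype.card_subtype_compl, Fintype.card_sum,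
            Fintype.card_coe, Finset.card_map]
        have hle : s.card ≤ Fintype.card τ := s.card_le_univ
        simp only [Nat.card_eq_fintype_card, Fintype.card_sum] at e₁ e₂ ⊢
        omega

/-- The preceding lemma with `B = 1`: the only relevant `s` is the whole index set. This then
removes the sign from that lemma. -/
theorem mem_neg {M : Matrix ι κ R} {α : ι → Γ} {β : κ → Γ} (hM : HasDegrees 𝒜 M α β)
    (hικ : Fintype.card ι = Fintype.card κ) (h : P.Mem M) : P.Mem (-M) := by
  classical
  have := mem_neg_mul_of_minors (P := P) hM (HasDegrees.one β) hικ fun s hs => Or.inl ?_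
  · simpa using this
  · obtain rfl : s = Finset.univ := by rw [← Finset.card_eq_iff_eq_univ, hs, hικ]
    exact (mem_submatrix_equiv_iff (Equiv.refl ι) (Equiv.subtypeUnivEquiv (by simp))).2 h

/-- A multiplicative substitute for the Cauchy-Binet formula. -/
theorem mem_mul_of_minors [DecidableEq τ] {A : Matrix ι τ R} {B : Matrix τ κ R}
    {α : ι → Γ} {ν : τ → Γ} {β : κ → Γ}
    (hA : HasDegrees 𝒜 A α ν) (hB : HasDegrees 𝒜 B ν β) (hικ : Fintype.card ι = Fintype.card κ)
    (h : ∀ s : Finset τ, s.card = Fintype.card ι →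
      P.Mem (A.submatrix id (Subtype.val : {x // x ∈ s} → τ)) ∨
        P.Mem (B.submatrix (Subtype.val : {x // x ∈ s} → τ) id)) : P.Mem (A * B) := by
  simpa using mem_neg (hA.mul hB).neg hικ (mem_neg_mul_of_minors hA hB hικ h)

end GrPrimeMatrixIdeal

/-! ### The rank function of a gr-prime matrix ideal. -/

namespace GrPrimeMatrixIdeal

variable {Γ : Type*} [AddGroup Γ] {R : Type*} [Ring R] {𝒜 : Γ → AddSubgroup R}
  (P : GrPrimeMatrixIdeal 𝒜)
variable {ι κ ι' κ' ι₁ ι₂ κ₁ κ₂ τ : Type*} [Fintype ι] [Fintype κ] [Fintype ι'] [Fintype κ']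
  [Fintype ι₁] [Fintype ι₂] [Fintype κ₁] [Fintype κ₂] [Fintype τ]

/-- The size of the largest square submatrix that does not belong to `P`. -/
noncomputable def minorRank {ι κ : Type*} (M : Matrix ι κ R) : ℕ :=
  sSup {k | ∃ (f : Fin k ↪ ι) (g : Fin k ↪ κ), ¬ P.Mem (M.submatrix f g)}

variable [SetLike.GradedMonoid 𝒜]

theorem isGreatest_minorRank {ι κ : Type*} [Fintype ι] (M : Matrix ι κ R) :
    IsGreatest {k | ∃ (f : Fin k ↪ ι) (g : Fin k ↪ κ), ¬ P.Mem (M.submatrix f g)}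
      (P.minorRank M) := by
  have hbdd : BddAbove {k | ∃ (f : Fin k ↪ ι) (g : Fin k ↪ κ), ¬ P.Mem (M.submatrix f g)} := by
    refine ⟨Fintype.card ι, ?_⟩
    rintro k ⟨f, -⟩
    simpa using Fintype.card_le_of_embedding f
  refine ⟨Nat.sSup_mem ⟨0, ⟨Fin.elim0, fun i => i.elim0⟩, ⟨Fin.elim0, fun i => i.elim0⟩, ?_⟩ hbdd,
    fun k hk => le_csSup hbdd hk⟩
  convert not_mem_one_fin (P := P) 0
  ext i
  exact i.elim0

variable {P}

theorem card_le_minorRank {ι κ ι' κ' : Type*} [Fintype ι] [Fintype ι'] [Fintype κ']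
    {M : Matrix ι κ R} (f : ι' ↪ ι) (g : κ' ↪ κ)
    (hcard : Fintype.card ι' = Fintype.card κ') (h : ¬ P.Mem (M.submatrix f g)) :
    Fintype.card ι' ≤ P.minorRank M := by
  let e := (Fintype.equivFin ι').symm
  let e' := (Fintype.equivFinOfCardEq hcard.symm).symm
  refine (P.isGreatest_minorRank M).2 ⟨e.toEmbedding.trans f, e'.toEmbedding.trans g, ?_⟩
  rwa [← mem_submatrix_equiv_iff e e'] at h

-- A largest minor of `A * B` outside `P` is the product of a set of rows of `A` and a set of
-- columns of `B`. By the Cauchy-Binet principle, some `s` gives minors of the same size in both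
-- factors.
omit [Fintype κ] in
theorem minorRank_mul_le {A : Matrix ι τ R} {B : Matrix τ κ R} {α : ι → Γ} {ν : τ → Γ}
    {β : κ → Γ} (hA : HasDegrees 𝒜 A α ν) (hB : HasDegrees 𝒜 B ν β) :
    P.minorRank (A * B) ≤ min (P.minorRank A) (P.minorRank B) := by
  classical
  obtain ⟨f, g, h⟩ := (P.isGreatest_minorRank (A * B)).1
  have key := mt (mem_mul_of_minors (P := P) (hA.submatrix f id) (hB.submatrix id g) rfl)
  rw [Matrix.submatrix_mul _ _ _ _ _ Function.bijective_id] at h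
  have := key h
  push Not at this
  obtain ⟨s, hs, h₁, h₂⟩ := this
  rw [Fintype.card_fin] at hs
  rw [← hs]
  have hc : Fintype.card {x // x ∈ s} = Fintype.card (Fin (P.minorRank (A * B))) := by simp [hs]
  rw [le_min_iff]
  constructor
  · have := card_le_minorRank (P := P) (M := A) f (.subtype fun x => x ∈ s) hc.symm h₁
    simpa [hs] using this
  · have := card_le_minorRank (P := P) (M := B) (.subtype fun x => x ∈ s) g hc h₂
    simpa using this

omit [Fintype κ₁] [Fintype κ₂] in
theorem le_minorRank_fromBlocks {A : Matrix ι₁ κ₁ R} {B : Matrix ι₂ κ₂ R}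
    {C : Matrix ι₁ κ₂ R} {α : ι₁ → Γ} {β : κ₁ → Γ} {δ : ι₂ → Γ} {ε : κ₂ → Γ}
    (hA : HasDegrees 𝒜 A α β) (hB : HasDegrees 𝒜 B δ ε) (hC : HasDegrees 𝒜 C α ε) :
    P.minorRank A + P.minorRank B ≤ P.minorRank (Matrix.fromBlocks A C 0 B) := by
  obtain ⟨f, g, h⟩ := (P.isGreatest_minorRank A).1
  obtain ⟨f', g', h'⟩ := (P.isGreatest_minorRank B).1
  have := card_le_minorRank (P := P) (M := Matrix.fromBlocks A C 0 B)
    (f.sumMap f') (g.sumMap g') (by simp) ?_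
  · simpa using this
  · have key := mem_fromBlocks_upper_iff (P := P) (hA.submatrix f g) (hB.submatrix f' g')
      (hC.submatrix f g') rfl rfl
    intro hmem
    refine (key.1 ?_).elim h h'
    convert hmem using 1
    ext (i | i) (j | j) <;> simp

-- A minor outside `P` must use as many rows as columns of `A`, since any imbalance creates too
-- large a zero block. It is then the diagonal sum of a minor of `A` and one of `B`.
omit [Fintype κ₁] [Fintype κ₂] in
theorem minorRank_fromBlocks_le {A : Matrix ι₁ κ₁ R} {B : Matrix ι₂ κ₂ R}
    {α : ι₁ → Γ} {β : κ₁ → Γ} {δ : ι₂ → Γ} {ε : κ₂ → Γ}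
    (hA : HasDegrees 𝒜 A α β) (hB : HasDegrees 𝒜 B δ ε) :
    P.minorRank (Matrix.fromBlocks A 0 0 B) ≤ P.minorRank A + P.minorRank B := by
  classical
  have hex := (P.isGreatest_minorRank (Matrix.fromBlocks A 0 0 B)).1
  generalize P.minorRank (Matrix.fromBlocks A 0 0 B) = k at hex ⊢
  obtain ⟨f, g, h⟩ := hex
  have hM := (hA.fromBlocks (.zero _ _) (.zero _ _) hB).submatrix f g
  have hf := Fintype.card_subtype_compl fun i => (f i).isLeft = true
  have hg := Fintype.card_subtype_compl fun i => (g i).isLeft = true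
  have hf' := Fintype.card_subtype_le fun i => (f i).isLeft = true
  have hg' := Fintype.card_subtype_le fun i => (g i).isLeft = true
  simp only [Fintype.card_fin] at hf hg hf' hg'
  obtain hlt | heq | hgt := lt_trichotomy (Fintype.card {i // (f i).isLeft})
    (Fintype.card {i // (g i).isLeft})
  · refine absurd (mem_of_zero_block hM (fun i => ¬ (f i).isLeft) (fun j => (g j).isLeft)
      ?_ ?_ rfl) h
    · intro i j hi hj
      rcases hfi : f i with x | x <;> rcases hgj : g j with y | y <;> simp_all
    · simp only [not_not, Nat.card_eq_fintype_card, Fintype.card_fin]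
      omega
  · let φ₁ : {i // (f i).isLeft} ↪ ι₁ := ⟨fun i => (f i).getLeft i.2, fun i j hij =>
      Subtype.ext (f.injective (by
        rw [← Sum.inl_getLeft (f i) i.2, ← Sum.inl_getLeft (f j) j.2]; exact congrArg _ hij))⟩
    let γ₁ : {i // (g i).isLeft} ↪ κ₁ := ⟨fun i => (g i).getLeft i.2, fun i j hij =>
      Subtype.ext (g.injective (by
        rw [← Sum.inl_getLeft (g i) i.2, ← Sum.inl_getLeft (g j) j.2]; exact congrArg _ hij))⟩
    let φ₂ : {i // ¬ (f i).isLeft} ↪ ι₂ := ⟨fun i => (f i).getRight (by simpa using i.2),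
      fun i j hij => Subtype.ext (f.injective (by
        rw [← Sum.inr_getRight (f i) (by simpa using i.2),
          ← Sum.inr_getRight (f j) (by simpa using j.2)]
        exact congrArg _ hij))⟩
    let γ₂ : {i // ¬ (g i).isLeft} ↪ κ₂ := ⟨fun i => (g i).getRight (by simpa using i.2),
      fun i j hij => Subtype.ext (g.injective (by
        rw [← Sum.inr_getRight (g i) (by simpa using i.2),
          ← Sum.inr_getRight (g j) (by simpa using j.2)]
        exact congrArg _ hij))⟩
    have hφ₁ : ∀ i, f i.1 = Sum.inl (φ₁ i) := fun i => (Sum.inl_getLeft (f i) i.2).symm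
    have hγ₁ : ∀ i, g i.1 = Sum.inl (γ₁ i) := fun i => (Sum.inl_getLeft (g i) i.2).symm
    have hφ₂ : ∀ i, f i.1 = Sum.inr (φ₂ i) := fun i => (Sum.inr_getRight (f i) _).symm
    have hγ₂ : ∀ i, g i.1 = Sum.inr (γ₂ i) := fun i => (Sum.inr_getRight (g i) _).symm
    have hc : Fintype.card {i // ¬ (f i).isLeft} = Fintype.card {i // ¬ (g i).isLeft} := by
      omega
    have key := mem_fromBlocks_diagonal_iff (P := P) (hA.submatrix φ₁ γ₁) (hB.submatrix φ₂ γ₂)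
      heq hc
    have h' : P.Mem (Matrix.fromBlocks (A.submatrix φ₁ γ₁) 0 0 (B.submatrix φ₂ γ₂)) ↔ False := by
      rw [← mem_submatrix_equiv_iff (Equiv.sumCompl fun i => (f i).isLeft = true)
        (Equiv.sumCompl fun i => (g i).isLeft = true)] at h
      convert (iff_false_intro h) using 2
      ext (i | i) (j | j)
      · simp [hφ₁, hγ₁]
      · simp [hφ₁, hγ₂]
      · simp [hφ₂, hγ₁]
      · simp [hφ₂, hγ₂]
    rw [key, iff_false, not_or] at h'
    have h₁ := card_le_minorRank φ₁ γ₁ heq h'.1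
    have h₂ := card_le_minorRank φ₂ γ₂ hc h'.2
    omega
  · refine absurd (mem_of_zero_block hM (fun i => (f i).isLeft) (fun j => ¬ (g j).isLeft)
      ?_ ?_ rfl) h
    · intro i j hi hj
      rcases hfi : f i with x | x <;> rcases hgj : g j with y | y <;> simp_all
    · simp only [not_not, Nat.card_eq_fintype_card, Fintype.card_fin]
      omega

theorem minorRank_submatrix_equiv {ι κ ι' κ' : Type*} [Fintype ι] [Fintype ι']
    {M : Matrix ι κ R} (e : ι' ≃ ι) (f : κ' ≃ κ) :
    P.minorRank (M.submatrix e f) = P.minorRank M := by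
  refine le_antisymm ?_ ?_
  · obtain ⟨u, v, h⟩ := (P.isGreatest_minorRank (M.submatrix e f)).1
    exact (P.isGreatest_minorRank M).2 ⟨u.trans e.toEmbedding, v.trans f.toEmbedding, h⟩
  · obtain ⟨u, v, h⟩ := (P.isGreatest_minorRank M).1
    refine (P.isGreatest_minorRank _).2
      ⟨u.trans e.symm.toEmbedding, v.trans f.symm.toEmbedding, ?_⟩
    convert h using 2
    ext
    simp

theorem minorRank_one_fin (n : ℕ) : P.minorRank (1 : Matrix (Fin n) (Fin n) R) = n := by
  refine le_antisymm ?_ ?_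
  · obtain ⟨f, -⟩ := (P.isGreatest_minorRank (1 : Matrix (Fin n) (Fin n) R)).1
    simpa using Fintype.card_le_of_embedding f
  · exact (P.isGreatest_minorRank _).2 ⟨.refl _, .refl _, not_mem_one_fin n⟩

theorem minorRank_lt_iff {n : ℕ} {A : Matrix (Fin n) (Fin n) R} :
    P.minorRank A < n ↔ A ∈ P.carrier n := by
  constructor
  · intro h
    by_contra hA
    rw [← mem_fin_iff] at hA
    exact h.not_ge ((P.isGreatest_minorRank A).2 ⟨.refl _, .refl _, hA⟩)
  · intro hA
    obtain ⟨f, g, h⟩ := (P.isGreatest_minorRank A).1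
    refine lt_of_le_of_ne (by simpa using Fintype.card_le_of_embedding f) fun heq => h ?_
    have hb : ∀ f : Fin (P.minorRank A) ↪ Fin n, Function.Bijective f := fun f =>
      (Fintype.bijective_iff_injective_and_card f).2 ⟨f.injective, by simp [heq]⟩
    exact (mem_submatrix_equiv_iff (Equiv.ofBijective f (hb f)) (Equiv.ofBijective g (hb g))).2
      (mem_fin_iff.2 hA)

variable (P)

/-- The gr-Sylvester matrix rank function attached to a gr-prime matrix ideal. -/
noncomputable def toRank : GrSylvesterMatrixRank 𝒜 where
  rk _ _ A := P.minorRank A.1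
  rk_one := minorRank_one_fin 1
  rk_mul_le hA hB := minorRank_mul_le hA hB
  rk_diagSum := by
    rintro m n m' n' ⟨A, α, β, hA⟩ ⟨B, δ, ε, hB⟩
    refine (minorRank_submatrix_equiv _ _).trans (le_antisymm (minorRank_fromBlocks_le hA hB) ?_)
    exact le_minorRank_fromBlocks hA hB (.zero _ _)
  le_rk_upperBlock hA hC hB :=
    (le_minorRank_fromBlocks hA hB hC).trans_eq (minorRank_submatrix_equiv _ _).symm

theorem isGreatest_toRank {m n : ℕ} (A : HomogeneousMatrix 𝒜 m n) :
    IsGreatest {k : ℕ | ∃ (f : Fin k ↪o Fin m) (g : Fin k ↪o Fin n),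
      A.1.submatrix f g ∉ P.carrier k} (P.toRank.rk m n A) := by
  change IsGreatest _ (P.minorRank A.1)
  convert P.isGreatest_minorRank A.1 using 1
  ext k
  constructor
  · rintro ⟨f, g, h⟩
    exact ⟨f.toEmbedding, g.toEmbedding, mem_fin_iff.not.2 h⟩
  · rintro ⟨f, g, h⟩
    -- Sorting the chosen rows and columns permutes the minor, which does not affect membership.
    let f' : Fin k ↪o Fin m := OrderEmbedding.ofStrictMono (f ∘ Tuple.sort f)
      ((Tuple.monotone_sort f).strictMono_of_injective (f.injective.comp (Equiv.injective _)))
    let g' : Fin k ↪o Fin n := OrderEmbedding.ofStrictMono (g ∘ Tuple.sort g)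
      ((Tuple.monotone_sort g).strictMono_of_injective (g.injective.comp (Equiv.injective _)))
    refine ⟨f', g', ?_⟩
    rwa [← mem_fin_iff, ← mem_submatrix_equiv_iff (Tuple.sort f).symm (Tuple.sort g).symm,
      show (A.1.submatrix f' g').submatrix (Tuple.sort f).symm (Tuple.sort g).symm =
        A.1.submatrix f g by ext i j; simp [f', g']]

end GrPrimeMatrixIdeal

/-! ### Basic properties of a gr-Sylvester matrix rank function. -/

namespace GrSylvesterMatrixRank

variable {Γ : Type*} [AddGroup Γ] {R : Type*} [Ring R] {𝒜 : Γ → AddSubgroup R}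
  [SetLike.GradedMonoid 𝒜] (ρ : GrSylvesterMatrixRank 𝒜)
variable {ι κ ι' κ' ι₁ ι₂ κ₁ κ₂ τ : Type*} [Fintype ι] [Fintype κ] [Fintype ι'] [Fintype κ']
  [Fintype ι₁] [Fintype ι₂] [Fintype κ₁] [Fintype κ₂] [Fintype τ]

theorem rk_congr {m n : ℕ} {A B : Matrix (Fin m) (Fin n) R} (h : A = B)
    (hA : IsHomogeneousMatrix 𝒜 A) (hB : IsHomogeneousMatrix 𝒜 B) :
    ρ.rk m n ⟨A, hA⟩ = ρ.rk m n ⟨B, hB⟩ := by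
  subst h
  rfl

omit [Fintype ι'] [Fintype κ'] in
theorem _root_.Matrix.submatrix_eq_one_mul_mul_one [DecidableEq ι] [DecidableEq κ]
    (M : Matrix ι κ R) (u : ι' → ι) (v : κ' → κ) :
    M.submatrix u v =
      (1 : Matrix ι ι R).submatrix u id * (M * (1 : Matrix κ κ R).submatrix id v) := by
  ext
  simp [Matrix.mul_apply, Matrix.one_apply]

/-- Selecting rows and columns, with repetitions allowed, is multiplication by homogeneous matrices
with entries `0` and `1`. -/
theorem rk_submatrix_le {m n m' n' : ℕ} {A : Matrix (Fin m) (Fin n) R} {α : Fin m → Γ}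
    {β : Fin n → Γ} (hA : HasDegrees 𝒜 A α β) (u : Fin m' → Fin m) (v : Fin n' → Fin n) :
    ρ.rk m' n' ⟨A.submatrix u v, hA.isHomogeneousMatrix u v⟩ ≤ ρ.rk m n ⟨A, α, β, hA⟩ := by
  have hu := (HasDegrees.one (𝒜 := 𝒜) α).submatrix u id
  have hv := (HasDegrees.one (𝒜 := 𝒜) β).submatrix id v
  have h₁ := (ρ.rk_mul_le hu (hA.mul hv)).trans (min_le_right _ _)
  have h₂ := (ρ.rk_mul_le hA hv).trans (min_le_left _ _)
  exact (ρ.rk_congr (A.submatrix_eq_one_mul_mul_one u v) _ _).trans_le (h₁.trans h₂)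

open Classical in
/-- The rank of a homogeneous matrix whose rows and columns are indexed by finite types. -/
noncomputable def rank (M : Matrix ι κ R) : ℕ :=
  -- The value `0` is a default for matrices that are not homogeneous.
  if h : IsHomogeneousMatrix 𝒜 (M.submatrix (Fintype.equivFin ι).symm (Fintype.equivFin κ).symm)
  then ρ.rk _ _ ⟨_, h⟩ else 0

variable {ρ}

theorem rank_eq_rk {M : Matrix ι κ R} {α : ι → Γ} {β : κ → Γ} (hM : HasDegrees 𝒜 M α β)
    {m n : ℕ} (e : Fin m ≃ ι) (f : Fin n ≃ κ) :
    ρ.rank M = ρ.rk m n ⟨M.submatrix e f, hM.isHomogeneousMatrix e f⟩ := by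
  rw [rank, dif_pos (hM.isHomogeneousMatrix _ _)]
  refine le_antisymm ?_ ?_
  · refine (ρ.rk_congr ?_ _ _).trans_le (ρ.rk_submatrix_le (hM.submatrix e f)
      (e.symm ∘ (Fintype.equivFin ι).symm) (f.symm ∘ (Fintype.equivFin κ).symm))
    ext
    simp
  · refine (ρ.rk_congr ?_ _ _).trans_le (ρ.rk_submatrix_le (hM.submatrix _ _)
      (Fintype.equivFin ι ∘ e) (Fintype.equivFin κ ∘ f))
    ext
    simp

theorem rank_fin {m n : ℕ} (A : HomogeneousMatrix 𝒜 m n) : ρ.rank A.1 = ρ.rk m n A := by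
  obtain ⟨A, α, β, hA⟩ := A
  exact rank_eq_rk hA (Equiv.refl _) (Equiv.refl _)

theorem rank_mul_le {A : Matrix ι τ R} {B : Matrix τ κ R} {α : ι → Γ} {ν : τ → Γ}
    {β : κ → Γ} (hA : HasDegrees 𝒜 A α ν) (hB : HasDegrees 𝒜 B ν β) :
    ρ.rank (A * B) ≤ min (ρ.rank A) (ρ.rank B) := by
  let e := (Fintype.equivFin ι).symm
  let f := (Fintype.equivFin κ).symm
  let g := (Fintype.equivFin τ).symm
  rw [rank_eq_rk hA e g, rank_eq_rk hB g f, rank_eq_rk (hA.mul hB) e f]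
  refine (ρ.rk_congr ?_ _ _).trans_le (ρ.rk_mul_le (hA.submatrix e g) (hB.submatrix g f))
  rw [Matrix.submatrix_mul_equiv]

theorem rank_mul_le_left {A : Matrix ι τ R} {B : Matrix τ κ R} {α : ι → Γ} {ν : τ → Γ}
    {β : κ → Γ} (hA : HasDegrees 𝒜 A α ν) (hB : HasDegrees 𝒜 B ν β) :
    ρ.rank (A * B) ≤ ρ.rank A :=
  (rank_mul_le hA hB).trans (min_le_left _ _)

theorem rank_mul_le_right {A : Matrix ι τ R} {B : Matrix τ κ R} {α : ι → Γ} {ν : τ → Γ}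
    {β : κ → Γ} (hA : HasDegrees 𝒜 A α ν) (hB : HasDegrees 𝒜 B ν β) :
    ρ.rank (A * B) ≤ ρ.rank B :=
  (rank_mul_le hA hB).trans (min_le_right _ _)

theorem rank_submatrix_le {M : Matrix ι κ R} {α : ι → Γ} {β : κ → Γ} (hM : HasDegrees 𝒜 M α β)
    (u : ι' → ι) (v : κ' → κ) : ρ.rank (M.submatrix u v) ≤ ρ.rank M := by
  classical
  have hu := (HasDegrees.one (𝒜 := 𝒜) α).submatrix u id
  have hv := (HasDegrees.one (𝒜 := 𝒜) β).submatrix id v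
  rw [M.submatrix_eq_one_mul_mul_one]
  exact (rank_mul_le_right hu (hM.mul hv)).trans (rank_mul_le_left hM hv)

theorem rank_fromBlocks_diagonal {A : Matrix ι₁ κ₁ R} {B : Matrix ι₂ κ₂ R}
    {α : ι₁ → Γ} {β : κ₁ → Γ} {δ : ι₂ → Γ} {ε : κ₂ → Γ}
    (hA : HasDegrees 𝒜 A α β) (hB : HasDegrees 𝒜 B δ ε) :
    ρ.rank (Matrix.fromBlocks A 0 0 B) = ρ.rank A + ρ.rank B := by
  let e₁ := (Fintype.equivFin ι₁).symm
  let f₁ := (Fintype.equivFin κ₁).symm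
  let e₂ := (Fintype.equivFin ι₂).symm
  let f₂ := (Fintype.equivFin κ₂).symm
  rw [rank_eq_rk hA e₁ f₁, rank_eq_rk hB e₂ f₂, ← ρ.rk_diagSum,
    rank_eq_rk (hA.fromBlocks (.zero _ _) (.zero _ _) hB)
      (finSumFinEquiv.symm.trans (Equiv.sumCongr e₁ e₂))
      (finSumFinEquiv.symm.trans (Equiv.sumCongr f₁ f₂))]
  refine ρ.rk_congr ?_ _ _
  ext i j
  rw [diagSum, upperBlock, Matrix.reindex_apply, Matrix.submatrix_apply, Matrix.submatrix_apply,
    Equiv.trans_apply, Equiv.trans_apply]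
  rcases finSumFinEquiv.symm i with i | i <;> rcases finSumFinEquiv.symm j with j | j <;> simp

theorem le_rank_fromBlocks {A : Matrix ι₁ κ₁ R} {B : Matrix ι₂ κ₂ R}
    {C : Matrix ι₁ κ₂ R} {α : ι₁ → Γ} {β : κ₁ → Γ} {δ : ι₂ → Γ} {ε : κ₂ → Γ}
    (hA : HasDegrees 𝒜 A α β) (hB : HasDegrees 𝒜 B δ ε) (hC : HasDegrees 𝒜 C α ε) :
    ρ.rank A + ρ.rank B ≤ ρ.rank (Matrix.fromBlocks A C 0 B) := by
  let e₁ := (Fintype.equivFin ι₁).symm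
  let f₁ := (Fintype.equivFin κ₁).symm
  let e₂ := (Fintype.equivFin ι₂).symm
  let f₂ := (Fintype.equivFin κ₂).symm
  rw [rank_eq_rk hA e₁ f₁, rank_eq_rk hB e₂ f₂,
    rank_eq_rk (hA.fromBlocks hC (.zero _ _) hB)
      (finSumFinEquiv.symm.trans (Equiv.sumCongr e₁ e₂))
      (finSumFinEquiv.symm.trans (Equiv.sumCongr f₁ f₂))]
  refine (ρ.le_rk_upperBlock (hA.submatrix e₁ f₁) (hC.submatrix e₁ f₂)
    (hB.submatrix e₂ f₂)).trans_eq (ρ.rk_congr ?_ _ _)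
  ext i j
  rw [upperBlock, Matrix.reindex_apply, Matrix.submatrix_apply, Matrix.submatrix_apply,
    Equiv.trans_apply, Equiv.trans_apply]
  rcases finSumFinEquiv.symm i with i | i <;> rcases finSumFinEquiv.symm j with j | j <;> simp

theorem rank_one_congr [DecidableEq ι] [DecidableEq κ] (e : ι ≃ κ) :
    ρ.rank (1 : Matrix ι ι R) = ρ.rank (1 : Matrix κ κ R) := by
  have h₁ := rank_submatrix_le (ρ := ρ) (HasDegrees.one (𝒜 := 𝒜) (0 : κ → Γ)) e e
  have h₂ := rank_submatrix_le (ρ := ρ) (HasDegrees.one (𝒜 := 𝒜) (0 : ι → Γ)) e.symm e.symm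
  rw [Matrix.submatrix_one_equiv] at h₁ h₂
  exact le_antisymm h₁ h₂

theorem rank_one [DecidableEq ι] : ρ.rank (1 : Matrix ι ι R) = Fintype.card ι := by
  have h (n : ℕ) := HasDegrees.one (𝒜 := 𝒜) (0 : Fin n → Γ)
  rw [rank_one_congr (Fintype.equivFin ι)]
  generalize Fintype.card ι = n
  induction n with
  | zero =>
    -- The empty matrix is its own diagonal double, so its rank equals twice itself.
    have h₁ := rank_fromBlocks_diagonal (ρ := ρ) (h 0) (h 0)
    rw [Matrix.fromBlocks_one, rank_one_congr (Equiv.emptySum (Fin 0) (Fin 0))] at h₁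
    omega
  | succ n ih =>
    have h₁ := rank_fromBlocks_diagonal (ρ := ρ) (h n) (h 1)
    have h₂ : ρ.rank (1 : Matrix (Fin 1) (Fin 1) R) = 1 := (rank_fin _).trans ρ.rk_one
    rwa [Matrix.fromBlocks_one, ih, h₂, rank_one_congr finSumFinEquiv] at h₁

theorem rank_le_card_cols {M : Matrix ι κ R} {α : ι → Γ} {β : κ → Γ}
    (hM : HasDegrees 𝒜 M α β) : ρ.rank M ≤ Fintype.card κ := by
  classical
  have := rank_mul_le_right (ρ := ρ) hM (HasDegrees.one β)
  rwa [Matrix.mul_one, rank_one] at this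

theorem rank_le_card_rows {M : Matrix ι κ R} {α : ι → Γ} {β : κ → Γ}
    (hM : HasDegrees 𝒜 M α β) : ρ.rank M ≤ Fintype.card ι := by
  classical
  have := rank_mul_le_left (ρ := ρ) (HasDegrees.one α) hM
  rwa [Matrix.one_mul, rank_one] at this

end GrSylvesterMatrixRank

/-! ### Submodularity of the rank in the set of columns or rows. -/

section Mask

variable {Γ : Type*} [AddGroup Γ] {R : Type*} [Ring R] {𝒜 : Γ → AddSubgroup R}
  [SetLike.GradedMonoid 𝒜] {ρ : GrSylvesterMatrixRank 𝒜}
variable {ι κ : Type*} [Fintype ι] [Fintype κ] [DecidableEq ι] [DecidableEq κ]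

/-- The diagonal idempotent matrix supported on `s`. -/
def mask (R : Type*) [Ring R] (s : Finset κ) : Matrix κ κ R :=
  Matrix.diagonal fun j => if j ∈ s then 1 else 0

omit [Fintype κ] in
theorem hasDegrees_mask (s : Finset κ) (β : κ → Γ) : HasDegrees 𝒜 (mask R s) β β :=
  HasDegrees.diagonal_ite _ β

theorem mask_mul_mask (s t : Finset κ) : mask R s * mask R t = mask R (s ∩ t) := by
  rw [mask, mask, mask, Matrix.diagonal_mul_diagonal]
  congr 1
  ext j
  by_cases hs : j ∈ s <;> by_cases ht : j ∈ t <;> simp [hs, ht]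

omit [Fintype κ] in
theorem mask_add_mask_sdiff (s t : Finset κ) :
    mask R s + mask R (t \ s) = mask R (s ∪ t) := by
  rw [mask, mask, mask, Matrix.diagonal_add]
  congr 1
  ext j
  by_cases hs : j ∈ s <;> by_cases ht : j ∈ t <;> simp [hs, ht]

theorem mask_univ : mask R (Finset.univ : Finset κ) = 1 := by
  simp [mask]

omit [Fintype ι] [DecidableEq ι] in
theorem mul_mask_apply (M : Matrix ι κ R) (s : Finset κ) (i : ι) (j : κ) :
    (M * mask R s) i j = if j ∈ s then M i j else 0 := by
  simp [mask]

omit [Fintype κ] [DecidableEq κ] in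
theorem mask_mul_apply (M : Matrix ι κ R) (s : Finset ι) (i : ι) (j : κ) :
    (mask R s * M) i j = if i ∈ s then M i j else 0 := by
  simp [mask]

namespace GrSylvesterMatrixRank

/-- Write `M_s` for `M * mask R s`. Multiplying the diagonal sum of `M_s` and `M_t` on both sides by
`hL` and `hR` gives the block triangular matrix with diagonal `M_(s ∩ t)`, `M_(s ∪ t)` and corner
`M_s`, to which axiom (4) applies. Masking instead of deleting columns keeps all blocks in one
format. -/
theorem rank_mul_mask_submodular {M : Matrix ι κ R} {α : ι → Γ} {β : κ → Γ}
    (hM : HasDegrees 𝒜 M α β) (s t : Finset κ) :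
    ρ.rank (M * mask R (s ∩ t)) + ρ.rank (M * mask R (s ∪ t)) ≤
      ρ.rank (M * mask R s) + ρ.rank (M * mask R t) := by
  have hm (s : Finset κ) := hasDegrees_mask (𝒜 := 𝒜) s β
  have h (s : Finset κ) := hM.mul (hm s)
  have hD := (h s).fromBlocks (.zero _ _) (.zero _ _) (h t)
  have hL := (HasDegrees.one (𝒜 := 𝒜) α).fromBlocks (.zero _ _) (.one α) (.one α)
  have hR := (hm (s ∩ t)).fromBlocks (hm s) (hm (s ∩ t)).neg (hm (t \ s))
  rw [← rank_fromBlocks_diagonal (h s) (h t)]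
  refine (le_rank_fromBlocks (h (s ∩ t)) (h (s ∪ t)) (h s)).trans ?_
  refine (le_of_eq ?_).trans ((rank_mul_le_right hL (hD.mul hR)).trans (rank_mul_le_left hD hR))
  rw [Matrix.fromBlocks_multiply, Matrix.fromBlocks_multiply]
  simp only [Matrix.mul_assoc, mask_mul_mask, Matrix.mul_neg, Matrix.zero_mul, Matrix.one_mul,
    neg_zero, add_zero, zero_add]
  rw [← Finset.inter_assoc, Finset.inter_self, Finset.inter_comm t (s ∩ t), Finset.inter_assoc,
    Finset.inter_self, Finset.inter_eq_right.2 Finset.sdiff_subset, add_neg_cancel,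
    ← Matrix.mul_add, mask_add_mask_sdiff]

theorem rank_mask_mul_submodular {M : Matrix ι κ R} {α : ι → Γ} {β : κ → Γ}
    (hM : HasDegrees 𝒜 M α β) (s t : Finset ι) :
    ρ.rank (mask R (s ∩ t) * M) + ρ.rank (mask R (s ∪ t) * M) ≤
      ρ.rank (mask R s * M) + ρ.rank (mask R t * M) := by
  have hm (s : Finset ι) := hasDegrees_mask (𝒜 := 𝒜) s α
  have h (s : Finset ι) := (hm s).mul hM
  have hD := (h s).fromBlocks (.zero _ _) (.zero _ _) (h t)
  have hR := (HasDegrees.one (𝒜 := 𝒜) β).fromBlocks (.one β) (.one β) (.zero _ _)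
  have hL := (hm s).fromBlocks (hm (t \ s)) (hm (s ∩ t)) (hm (s ∩ t)).neg
  rw [← rank_fromBlocks_diagonal (h s) (h t), add_comm]
  refine (le_rank_fromBlocks (h (s ∪ t)) (h (s ∩ t)) (h s)).trans ?_
  refine (le_of_eq ?_).trans ((rank_mul_le_right hL (hD.mul hR)).trans (rank_mul_le_left hD hR))
  rw [Matrix.fromBlocks_multiply, Matrix.fromBlocks_multiply]
  simp only [← Matrix.mul_assoc, mask_mul_mask, Matrix.neg_mul, Matrix.mul_zero, Matrix.mul_one,
    add_zero, zero_add]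
  rw [Finset.inter_comm (s ∩ t) s, ← Finset.inter_assoc, Finset.inter_self, Finset.inter_assoc,
    Finset.inter_self, Finset.inter_eq_left.2 Finset.sdiff_subset, add_neg_cancel, ← Matrix.add_mul,
    mask_add_mask_sdiff]

-- The masked matrix factors through the submatrix of the columns that are kept, so bounds for
-- submatrices pass to it.
omit [DecidableEq ι] in
theorem rank_mul_mask_le {M : Matrix ι κ R} {α : ι → Γ} {β : κ → Γ}
    (hM : HasDegrees 𝒜 M α β) (s : Finset κ) :
    ρ.rank (M * mask R s) ≤ ρ.rank (M.submatrix id (Subtype.val : {j // j ∈ s} → κ)) := by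
  refine (le_of_eq ?_).trans (rank_mul_le_left (hM.submatrix id (Subtype.val : {j // j ∈ s} → κ))
    ((HasDegrees.one β).submatrix Subtype.val id))
  congr 1
  ext i j
  rw [mul_mask_apply, Matrix.mul_apply]
  split_ifs with hj
  · rw [Finset.sum_eq_single ⟨j, hj⟩]
    · simp [Matrix.one_apply]
    · rintro ⟨x, hx⟩ - hxj
      have : x ≠ j := fun h => hxj (Subtype.ext h)
      simp [this]
    · simp
  · rw [Finset.sum_eq_zero]
    rintro ⟨x, hx⟩ -
    have : x ≠ j := fun h => hj (h ▸ hx)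
    simp [this]

omit [DecidableEq κ] in
theorem rank_mask_mul_le {M : Matrix ι κ R} {α : ι → Γ} {β : κ → Γ}
    (hM : HasDegrees 𝒜 M α β) (s : Finset ι) :
    ρ.rank (mask R s * M) ≤ ρ.rank (M.submatrix (Subtype.val : {j // j ∈ s} → ι) id) := by
  refine (le_of_eq ?_).trans (rank_mul_le_right ((HasDegrees.one α).submatrix id Subtype.val)
    (hM.submatrix (Subtype.val : {j // j ∈ s} → ι) id))
  congr 1
  ext i j
  rw [mask_mul_apply, Matrix.mul_apply]
  split_ifs with hi
  · rw [Finset.sum_eq_single ⟨i, hi⟩]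
    · simp [Matrix.one_apply]
    · rintro ⟨x, hx⟩ - hxi
      have : i ≠ x := fun h => hxi (Subtype.ext h.symm)
      simp [this]
    · simp
  · rw [Finset.sum_eq_zero]
    rintro ⟨x, hx⟩ -
    have : i ≠ x := fun h => hi (h ▸ hx)
    simp [this]

end GrSylvesterMatrixRank

/-- A submodular function on finsets attains its value at `univ` on a set of that cardinality. -/
theorem exists_card_eq_of_submodular (r : Finset κ → ℕ) (hcard : ∀ s, r s ≤ s.card)
    (hmono : ∀ s t, s ⊆ t → r s ≤ r t)
    (hsub : ∀ s t, r (s ∩ t) + r (s ∪ t) ≤ r s + r t) : ∃ s, s.card = r s ∧ r s = r .univ := by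
  -- As in a matroid, `s` is a largest independent set, meaning `s.card = r s`; the empty set is
  -- independent.
  obtain ⟨s, hs, hmax⟩ := Finset.exists_max_image
    (Finset.univ.filter fun s : Finset κ => s.card = r s) Finset.card
    ⟨∅, by have := hcard ∅; simp at this; simp [this]⟩
  simp only [Finset.mem_filter, Finset.mem_univ, true_and] at hs hmax
  have hins : ∀ j, r (insert j s) = r s := by
    intro j
    by_cases hj : j ∈ s
    · rw [Finset.insert_eq_of_mem hj]
    · have h₁ := hsub s {j}
      have h₂ := hcard {j}
      have h₃ := hmono s (insert j s) (Finset.subset_insert _ _)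
      rw [Finset.union_comm, ← Finset.insert_eq] at h₁
      rw [Finset.card_singleton] at h₂
      by_contra hne
      have := hmax (insert j s) (by rw [Finset.card_insert_of_notMem hj]; omega)
      rw [Finset.card_insert_of_notMem hj] at this
      omega
  -- No single element raises the value at `s`; by submodularity, adding elements one after another
  -- does not either.
  have hunion : ∀ t, r (s ∪ t) = r s := by
    intro t
    induction t using Finset.induction with
    | empty => simp
    | insert j t _ ih =>
      have h₁ := hsub (s ∪ t) (insert j s)
      have h₂ := hmono s ((s ∪ t) ∩ insert j s)
        (Finset.subset_inter Finset.subset_union_left (Finset.subset_insert _ _))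
      have h₃ := hmono s (s ∪ insert j t) Finset.subset_union_left
      have h₄ : (s ∪ t) ∪ insert j s = s ∪ insert j t := by
        ext
        simp only [Finset.mem_union, Finset.mem_insert]
        tauto
      rw [h₄, ih, hins] at h₁
      omega
  exact ⟨s, hs, by rw [← hunion .univ, Finset.union_eq_right.2 (Finset.subset_univ s)]⟩

end Mask

/-! ### Minors of full rank and the ideal of a rank function. -/

namespace GrSylvesterMatrixRank

variable {Γ : Type*} [AddGroup Γ] {R : Type*} [Ring R] {𝒜 : Γ → AddSubgroup R}
  [SetLike.GradedMonoid 𝒜] {ρ : GrSylvesterMatrixRank 𝒜}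
variable {ι κ : Type*} [Fintype ι] [Fintype κ]

theorem rank_mul_mask_le_card [DecidableEq κ] {M : Matrix ι κ R} {α : ι → Γ} {β : κ → Γ}
    (hM : HasDegrees 𝒜 M α β) (s : Finset κ) : ρ.rank (M * mask R s) ≤ s.card := by
  simpa using (rank_mul_mask_le (ρ := ρ) hM s).trans
    (rank_le_card_cols (hM.submatrix id Subtype.val))

theorem rank_mask_mul_le_card [DecidableEq ι] {M : Matrix ι κ R} {α : ι → Γ} {β : κ → Γ}
    (hM : HasDegrees 𝒜 M α β) (s : Finset ι) : ρ.rank (mask R s * M) ≤ s.card := by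
  simpa using (rank_mask_mul_le (ρ := ρ) hM s).trans
    (rank_le_card_rows (hM.submatrix Subtype.val id))

theorem exists_cols_rank_eq {M : Matrix ι κ R} {α : ι → Γ} {β : κ → Γ}
    (hM : HasDegrees 𝒜 M α β) : ∃ s : Finset κ, s.card = ρ.rank M ∧
      ρ.rank (M.submatrix id (Subtype.val : {j // j ∈ s} → κ)) = ρ.rank M := by
  classical
  have hmono (s t : Finset κ) (hst : s ⊆ t) :
      ρ.rank (M * mask R s) ≤ ρ.rank (M * mask R t) := by
    have := rank_mul_le_left (ρ := ρ) (hM.mul (hasDegrees_mask t β)) (hasDegrees_mask s β)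
    rwa [Matrix.mul_assoc, mask_mul_mask, Finset.inter_eq_right.2 hst] at this
  obtain ⟨s, hs, hr⟩ := exists_card_eq_of_submodular (fun s => ρ.rank (M * mask R s))
    (rank_mul_mask_le_card hM) hmono (rank_mul_mask_submodular hM)
  simp only [mask_univ, Matrix.mul_one] at hr hs
  exact ⟨s, hs.trans hr, (rank_submatrix_le hM _ _).antisymm
    (hr.symm.trans_le (rank_mul_mask_le hM s))⟩

theorem exists_rows_rank_eq {M : Matrix ι κ R} {α : ι → Γ} {β : κ → Γ}
    (hM : HasDegrees 𝒜 M α β) : ∃ s : Finset ι, s.card = ρ.rank M ∧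
      ρ.rank (M.submatrix (Subtype.val : {i // i ∈ s} → ι) id) = ρ.rank M := by
  classical
  have hmono (s t : Finset ι) (hst : s ⊆ t) :
      ρ.rank (mask R s * M) ≤ ρ.rank (mask R t * M) := by
    have := rank_mul_le_right (ρ := ρ) (hasDegrees_mask s α) ((hasDegrees_mask t α).mul hM)
    rwa [← Matrix.mul_assoc, mask_mul_mask, Finset.inter_eq_left.2 hst] at this
  obtain ⟨s, hs, hr⟩ := exists_card_eq_of_submodular (fun s => ρ.rank (mask R s * M))
    (rank_mask_mul_le_card hM) hmono (rank_mask_mul_submodular hM)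
  simp only [mask_univ, Matrix.one_mul] at hr hs
  exact ⟨s, hs.trans hr, (rank_submatrix_le hM _ _).antisymm
    (hr.symm.trans_le (rank_mask_mul_le hM s))⟩

/-- A homogeneous matrix of rank `r` has an `r × r` submatrix of rank `r`. -/
theorem exists_minor_rank_eq {M : Matrix ι κ R} {α : ι → Γ} {β : κ → Γ}
    (hM : HasDegrees 𝒜 M α β) : ∃ (f : Fin (ρ.rank M) ↪ ι) (g : Fin (ρ.rank M) ↪ κ),
      ρ.rank (M.submatrix f g) = ρ.rank M := by
  obtain ⟨s, hs, hrs⟩ := exists_cols_rank_eq (ρ := ρ) hM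
  have hM' := hM.submatrix id (Subtype.val : {j // j ∈ s} → κ)
  -- The rows are chosen inside the submatrix of the chosen columns, whose rank is still that of
  -- `M`.
  obtain ⟨t, ht, hrt⟩ := exists_rows_rank_eq (ρ := ρ) hM'
  let e := (Finset.equivFinOfCardEq (ht.trans hrs)).symm
  let e' := (Finset.equivFinOfCardEq hs).symm
  refine ⟨e.toEmbedding.trans (.subtype _), e'.toEmbedding.trans (.subtype _),
    (rank_submatrix_le hM _ _).antisymm ?_⟩
  have hM'' := (hM'.submatrix (Subtype.val : {i // i ∈ t} → ι) id).submatrix e e'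
  have := rank_submatrix_le (ρ := ρ) hM'' e.symm e'.symm
  refine (hrt.trans hrs).symm.trans_le ((le_of_eq ?_).trans this)
  congr 1
  ext
  simp

/-- Let `N` be `A` with column `k` of `B` appended, let `N₀` be the columns common to `A` and `B`,
and let `n` be the number of columns of `A`. Submodularity gives `rank N + rank N₀ ≤ rank A + rank B
≤ 2n - 2`. The determinantal sum `D` satisfies `rank D ≤ rank N` and, having one column besides
those of `N₀`, `rank D ≤ rank N₀ + 1`. Adding, `2 * rank D ≤ 2n - 1`. -/
theorem rank_updateCol_lt [DecidableEq κ] {A B : Matrix ι κ R} {α : ι → Γ} {β : κ → Γ}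
    (k : κ) (hA : HasDegrees 𝒜 A α β) (hB : HasDegrees 𝒜 B α β)
    (hAB : ∀ i j, j ≠ k → A i j = B i j)
    (hrA : ρ.rank A < Fintype.card κ) (hrB : ρ.rank B < Fintype.card κ) :
    ρ.rank (A.updateCol k (A.col k + B.col k)) < Fintype.card κ := by
  have := Classical.decEq ι
  let N : Matrix ι (κ ⊕ Unit) R := Matrix.fromCols A (B.submatrix id fun _ => k)
  let h : κ ⊕ Unit → κ := Sum.elim id fun _ => k
  have hN : HasDegrees 𝒜 N α (β ∘ h) := by
    rintro i (j | j)
    exacts [hA i j, hB i k]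
  let T : Matrix (κ ⊕ Unit) κ R := Matrix.fromRows 1 ((1 : Matrix κ κ R).submatrix (fun _ => k) id)
  have hT : HasDegrees 𝒜 T (β ∘ h) β := by
    rintro (i | i) j
    exacts [HasDegrees.one β i j, HasDegrees.one β k j]
  let D := A.updateCol k (A.col k + B.col k)
  have hDN : D = N * T := by
    ext i j
    rw [Matrix.fromCols_mul_fromRows]
    by_cases hj : j = k
    · simp [D, hj, Matrix.mul_apply, Matrix.one_apply]
    · simp [D, hj, Matrix.mul_apply, Ne.symm hj]
  have hD : HasDegrees 𝒜 D α β := hDN ▸ hN.mul hT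
  -- The columns in `s` form `A`; those in `t` form `B`, with column `k` moved to the end.
  let s : Finset (κ ⊕ Unit) := Finset.univ.erase (Sum.inr ())
  let t : Finset (κ ⊕ Unit) := Finset.univ.erase (Sum.inl k)
  have h₁ : ρ.rank (N * mask R s) ≤ ρ.rank A := by
    refine (rank_mul_mask_le hN _).trans ((le_of_eq ?_).trans
      (rank_submatrix_le hA id (fun x : {x // x ∈ s} => h x)))
    congr 1
    ext i ⟨j | j, hj⟩
    · rfl
    · simp [s] at hj
  have h₂ : ρ.rank (N * mask R t) ≤ ρ.rank B := by
    refine (rank_mul_mask_le hN _).trans ((le_of_eq ?_).trans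
      (rank_submatrix_le hB id (fun x : {x // x ∈ t} => h x)))
    congr 1
    ext i ⟨j | j, hj⟩
    · exact hAB i j (by simpa [t] using hj)
    · rfl
  have h₃ := rank_mul_mask_submodular (ρ := ρ) hN s t
  have hu : s ∪ t = Finset.univ := by
    ext (j | j) <;> simp [s, t]
  rw [hu, mask_univ, Matrix.mul_one] at h₃
  have h₄ : ρ.rank D ≤ ρ.rank N := hDN ▸ rank_mul_le_left hN hT
  have h₅ : ρ.rank (D * mask R (Finset.univ.erase k)) ≤ ρ.rank (N * mask R (s ∩ t)) := by
    refine (le_of_eq ?_).trans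
      (rank_submatrix_le (hN.mul (hasDegrees_mask (s ∩ t) _)) id (Sum.inl : κ → κ ⊕ Unit))
    congr 1
    ext i j
    rw [mul_mask_apply, Matrix.submatrix_apply, mul_mask_apply]
    by_cases hj : j = k <;> simp [s, t, hj, D, N]
  have h₆ := rank_mul_mask_submodular (ρ := ρ) hD (Finset.univ.erase k) {k}
  have h₇ := rank_mul_mask_le_card (ρ := ρ) hD {k}
  rw [show Finset.univ.erase k ∪ {k} = Finset.univ by ext j; simp, mask_univ,
    Matrix.mul_one] at h₆
  rw [Finset.card_singleton] at h₇
  change ρ.rank D < _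
  omega

theorem rank_updateRow_lt [DecidableEq ι] {A B : Matrix ι κ R} {α : ι → Γ} {β : κ → Γ}
    (k : ι) (hA : HasDegrees 𝒜 A α β) (hB : HasDegrees 𝒜 B α β)
    (hAB : ∀ i j, i ≠ k → A i j = B i j)
    (hrA : ρ.rank A < Fintype.card ι) (hrB : ρ.rank B < Fintype.card ι) :
    ρ.rank (A.updateRow k (A.row k + B.row k)) < Fintype.card ι := by
  have := Classical.decEq κ
  let N : Matrix (ι ⊕ Unit) κ R := Matrix.fromRows A (B.submatrix (fun _ => k) id)
  let h : ι ⊕ Unit → ι := Sum.elim id fun _ => k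
  have hN : HasDegrees 𝒜 N (α ∘ h) β := by
    rintro (i | i) j
    exacts [hA i j, hB k j]
  let T : Matrix ι (ι ⊕ Unit) R := Matrix.fromCols 1 ((1 : Matrix ι ι R).submatrix id fun _ => k)
  have hT : HasDegrees 𝒜 T α (α ∘ h) := by
    rintro i (j | j)
    exacts [HasDegrees.one α i j, HasDegrees.one α i k]
  let D := A.updateRow k (A.row k + B.row k)
  have hDN : D = T * N := by
    ext i j
    rw [Matrix.fromCols_mul_fromRows]
    by_cases hi : i = k
    · simp [D, hi, Matrix.mul_apply, Matrix.one_apply]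
    · simp [D, hi, Matrix.mul_apply]
  have hD : HasDegrees 𝒜 D α β := hDN ▸ hT.mul hN
  let s : Finset (ι ⊕ Unit) := Finset.univ.erase (Sum.inr ())
  let t : Finset (ι ⊕ Unit) := Finset.univ.erase (Sum.inl k)
  have h₁ : ρ.rank (mask R s * N) ≤ ρ.rank A := by
    refine (rank_mask_mul_le hN _).trans ((le_of_eq ?_).trans
      (rank_submatrix_le hA (fun x : {x // x ∈ s} => h x) id))
    congr 1
    ext ⟨i | i, hi⟩ j
    · rfl
    · simp [s] at hi
  have h₂ : ρ.rank (mask R t * N) ≤ ρ.rank B := by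
    refine (rank_mask_mul_le hN _).trans ((le_of_eq ?_).trans
      (rank_submatrix_le hB (fun x : {x // x ∈ t} => h x) id))
    congr 1
    ext ⟨i | i, hi⟩ j
    · exact hAB i j (by simpa [t] using hi)
    · rfl
  have h₃ := rank_mask_mul_submodular (ρ := ρ) hN s t
  have hu : s ∪ t = Finset.univ := by
    ext (i | i) <;> simp [s, t]
  rw [hu, mask_univ, Matrix.one_mul] at h₃
  have h₄ : ρ.rank D ≤ ρ.rank N := hDN ▸ rank_mul_le_right hT hN
  have h₅ : ρ.rank (mask R (Finset.univ.erase k) * D) ≤ ρ.rank (mask R (s ∩ t) * N) := by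
    refine (le_of_eq ?_).trans
      (rank_submatrix_le ((hasDegrees_mask (s ∩ t) _).mul hN) (Sum.inl : ι → ι ⊕ Unit) id)
    congr 1
    ext i j
    rw [mask_mul_apply, Matrix.submatrix_apply, mask_mul_apply]
    by_cases hi : i = k <;> simp [s, t, hi, D, N]
  have h₆ := rank_mask_mul_submodular (ρ := ρ) hD (Finset.univ.erase k) {k}
  have h₇ := rank_mask_mul_le_card (ρ := ρ) hD {k}
  rw [show Finset.univ.erase k ∪ {k} = Finset.univ by ext j; simp, mask_univ,
    Matrix.one_mul] at h₆
  rw [Finset.card_singleton] at h₇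
  change ρ.rank D < _
  omega

variable (ρ)

/-- The gr-prime matrix ideal attached to a gr-Sylvester matrix rank function. -/
noncomputable def toIdeal : GrPrimeMatrixIdeal 𝒜 where
  -- Homogeneity is required separately because of the default value of `rank`.
  carrier n := {A | IsHomogeneousMatrix 𝒜 A ∧ ρ.rank A < n}
  isHomogeneous h := h.1
  not_grFull_mem := by
    intro n A hA hfull
    refine ⟨hA, ?_⟩
    simp only [IsGrFull, not_forall] at hfull
    obtain ⟨r, α, β, ν, B, C, hB, hC, rfl, hr⟩ := hfull
    have h₁ := rank_mul_le_left (ρ := ρ) hB hC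
    have h₂ := rank_le_card_cols (ρ := ρ) hB
    rw [Fintype.card_fin] at h₂
    omega
  col_sum_mem := by
    intro n A B α β k hA hB hAB hrA hrB
    have hD : HasDegrees 𝒜 (A.updateCol k (A.col k + B.col k)) α β := by
      intro i j
      rw [Matrix.updateCol_apply]
      split_ifs with hj
      · subst hj
        exact (𝒜 _).add_mem (hA i j) (hB i j)
      · exact hA i j
    have := rank_updateCol_lt (ρ := ρ) k hA hB hAB
    rw [Fintype.card_fin] at this
    exact ⟨⟨α, β, hD⟩, this hrA.2 hrB.2⟩
  row_sum_mem := by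
    intro n A B α β k hA hB hAB hrA hrB
    have hD : HasDegrees 𝒜 (A.updateRow k (A.row k + B.row k)) α β := by
      intro i j
      rw [Matrix.updateRow_apply]
      split_ifs with hi
      · subst hi
        exact (𝒜 _).add_mem (hA i j) (hB i j)
      · exact hA i j
    have := rank_updateRow_lt (ρ := ρ) k hA hB hAB
    rw [Fintype.card_fin] at this
    exact ⟨⟨α, β, hD⟩, this hrA.2 hrB.2⟩
  diagSum_mem := by
    intro m n A B hA hB
    have h := (rank_fin _).trans (ρ.rk_diagSum ⟨A, hA.1⟩ ⟨B, hB⟩)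
    rw [← rank_fin, ← rank_fin] at h
    refine ⟨hA.1.diagSum hB, ?_⟩
    obtain ⟨α, β, hB⟩ := hB
    have := rank_le_card_cols (ρ := ρ) hB
    rw [Fintype.card_fin] at this
    have := hA.2
    dsimp only at h
    omega
  mem_or_mem := by
    intro m n A B hA hB hAB
    have h := (rank_fin _).trans (ρ.rk_diagSum ⟨A, hA⟩ ⟨B, hB⟩)
    rw [← rank_fin, ← rank_fin] at h
    by_contra! hne
    have h₁ := not_and.1 hne.1 hA
    have h₂ := not_and.1 hne.2 hB
    have := hAB.2
    dsimp only at h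
    omega
  one_notMem h := by
    have := h.2
    simp [rank_one] at this
  perm_mem := by
    rintro n A σ τ ⟨⟨α, β, hA⟩, hr⟩
    rw [Equiv.Perm.permMatrix, Equiv.Perm.permMatrix, PEquiv.toMatrix_toPEquiv_mul,
      PEquiv.mul_toMatrix_toPEquiv, Matrix.submatrix_submatrix]
    have hA' : HasDegrees 𝒜 A α β := hA
    exact ⟨hA'.isHomogeneousMatrix _ _, (rank_submatrix_le hA' _ _).trans_lt hr⟩

theorem mem_toIdeal_iff {n : ℕ} {A : Matrix (Fin n) (Fin n) R} :
    A ∈ ρ.toIdeal.carrier n ↔ ∃ hA : IsHomogeneousMatrix 𝒜 A, ρ.rk n n ⟨A, hA⟩ < n := by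
  constructor
  · rintro ⟨hA, h⟩
    exact ⟨hA, by rwa [← rank_fin]⟩
  · rintro ⟨hA, h⟩
    exact ⟨hA, by rwa [← rank_fin] at h⟩

/-- A homogeneous `k × k` minor is outside the ideal exactly when its rank is at least `k`. Minors
have rank at most that of `A`, and `exists_minor_rank_eq` attains the bound. -/
theorem toRank_toIdeal : ρ.toIdeal.toRank = ρ := by
  ext m n ⟨A, α, β, hA⟩
  have hA' : HasDegrees 𝒜 A α β := hA
  rw [← rank_fin (ρ := ρ)]
  change ρ.toIdeal.minorRank A = ρ.rank A
  refine (ρ.toIdeal.isGreatest_minorRank A).unique ⟨?_, ?_⟩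
  · obtain ⟨f, g, h⟩ := exists_minor_rank_eq (ρ := ρ) hA'
    refine ⟨f, g, fun hmem => ?_⟩
    exact (GrPrimeMatrixIdeal.mem_fin_iff.1 hmem).2.ne h
  · rintro k ⟨f, g, h⟩
    rw [GrPrimeMatrixIdeal.mem_fin_iff] at h
    have := not_and.1 h (hA'.isHomogeneousMatrix f g)
    exact (not_lt.1 this).trans (rank_submatrix_le hA' f g)

end GrSylvesterMatrixRank

/-! ### The anti-isomorphism. -/

namespace GrPrimeMatrixIdeal

variable {Γ : Type*} [AddGroup Γ] {R : Type*} [Ring R] {𝒜 : Γ → AddSubgroup R}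
  [SetLike.GradedMonoid 𝒜]

theorem toIdeal_toRank (P : GrPrimeMatrixIdeal 𝒜) : P.toRank.toIdeal = P := by
  ext n A
  rw [GrSylvesterMatrixRank.mem_toIdeal_iff]
  constructor
  · rintro ⟨_, h⟩
    exact minorRank_lt_iff.1 h
  · intro h
    exact ⟨P.isHomogeneous h, minorRank_lt_iff.2 h⟩

/-- The anti-isomorphism between gr-prime matrix ideals and gr-Sylvester matrix rank functions. -/
noncomputable def orderIsoRank : GrPrimeMatrixIdeal 𝒜 ≃o (GrSylvesterMatrixRank 𝒜)ᵒᵈ where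
  toFun P := OrderDual.toDual P.toRank
  invFun ρ := (OrderDual.ofDual ρ).toIdeal
  left_inv := toIdeal_toRank
  right_inv ρ := congrArg OrderDual.toDual (OrderDual.ofDual ρ).toRank_toIdeal
  map_rel_iff' := by
    intro P Q
    constructor
    · intro h n A hA
      have := h n n ⟨A, P.isHomogeneous hA⟩
      exact minorRank_lt_iff.1 (this.trans_lt (minorRank_lt_iff.2 hA))
    · intro h m n A
      obtain ⟨f, g, hfg⟩ := (Q.isGreatest_minorRank A.1).1
      refine (P.isGreatest_minorRank A.1).2 ⟨f, g, fun hmem => hfg ?_⟩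
      rw [mem_fin_iff] at hmem ⊢
      exact h _ hmem

end GrPrimeMatrixIdeal

/-! ### Linear algebra over a graded division ring. -/

section GradedDivisionRing

variable {Γ : Type*} [AddGroup Γ] [DecidableEq Γ] {K : Type*} [Ring K] {𝒦 : Γ → AddSubgroup K}
  [GradedRing 𝒦]

/-- The entrywise projection onto the homogeneous matrices with given degrees. -/
def homogeneousPart (𝒦 : Γ → AddSubgroup K) [GradedRing 𝒦] {ι κ : Type*} (α : ι → Γ) (β : κ → Γ)
    (M : Matrix ι κ K) : Matrix ι κ K :=
  Matrix.of fun i j => (DirectSum.decompose 𝒦 (M i j) (α i - β j) : K)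

theorem hasDegrees_homogeneousPart {ι κ : Type*} (α : ι → Γ) (β : κ → Γ) (M : Matrix ι κ K) :
    HasDegrees 𝒦 (homogeneousPart 𝒦 α β M) α β :=
  fun _ _ => SetLike.coe_mem _

theorem HasDegrees.homogeneousPart_eq {ι κ : Type*} {M : Matrix ι κ K} {α : ι → Γ} {β : κ → Γ}
    (hM : HasDegrees 𝒦 M α β) : homogeneousPart 𝒦 α β M = M := by
  ext i j
  exact DirectSum.decompose_of_mem_same 𝒦 (hM i j)

/-- This allows a solution `N` of a homogeneous matrix equation to be replaced by its homogeneous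
part. -/
theorem HasDegrees.homogeneousPart_mul {ι κ τ : Type*} [Fintype κ] {M : Matrix ι κ K}
    {α : ι → Γ} {β : κ → Γ} (hM : HasDegrees 𝒦 M α β) (N : Matrix κ τ K) (ε : τ → Γ) :
    homogeneousPart 𝒦 α ε (M * N) = M * homogeneousPart 𝒦 β ε N := by
  ext i j
  simp only [homogeneousPart, Matrix.of_apply, Matrix.mul_apply, DirectSum.decompose_sum]
  rw [DFinsupp.finsetSum_apply, AddSubgroup.val_finsetSum]
  refine Finset.sum_congr rfl fun k _ => ?_
  rw [← sub_add_sub_cancel (α i) (β k) (ε j)]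
  exact DirectSum.coe_decompose_mul_add_of_left_mem 𝒦 (hM i k)

/-- The homogeneous part of `N` is again a right inverse of `M`, and a two-sided inverse is the only
right inverse. -/
theorem HasDegrees.of_mul_eq_one {ι κ : Type*} [Fintype ι] [Fintype κ] [DecidableEq ι]
    [DecidableEq κ] {M : Matrix ι κ K} {N : Matrix κ ι K} {α : ι → Γ} {β : κ → Γ}
    (hM : HasDegrees 𝒦 M α β) (h : M * N = 1) (h' : N * M = 1) : HasDegrees 𝒦 N β α := by
  have h₁ := hM.homogeneousPart_mul N α
  rw [h, (HasDegrees.one α).homogeneousPart_eq] at h₁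
  have h₂ : N = homogeneousPart 𝒦 β α N := by
    calc N = N * (M * homogeneousPart 𝒦 β α N) := by rw [← h₁, Matrix.mul_one]
      _ = homogeneousPart 𝒦 β α N := by rw [← Matrix.mul_assoc, h', Matrix.one_mul]
  rw [h₂]
  exact hasDegrees_homogeneousPart β α N

/-- The matrix is a product of a lower unitriangular, a block diagonal and an upper unitriangular
matrix, the middle one holding `S` and its Schur complement. -/
theorem isUnit_fromBlocks_of_schur {ι : Type*} [Fintype ι] [DecidableEq ι]
    {S T : Matrix ι ι K} (hST : S * T = 1) (hTS : T * S = 1) (x : Matrix ι Unit K)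
    (y : Matrix Unit ι K) (z : Matrix Unit Unit K) (hd : IsUnit (z - y * T * x)) :
    IsUnit (Matrix.fromBlocks S x y z) := by
  have hS : IsUnit (Matrix.fromBlocks S 0 0 (z - y * T * x)) := by
    obtain ⟨⟨d, d', h, h'⟩, hd⟩ := hd
    rw [← hd]
    refine ⟨⟨Matrix.fromBlocks S 0 0 d, Matrix.fromBlocks T 0 0 d', ?_, ?_⟩, rfl⟩ <;>
      simp [Matrix.fromBlocks_multiply, hST, hTS, h, h']
  have hL : IsUnit (Matrix.fromBlocks (1 : Matrix ι ι K) 0 (y * T) (1 : Matrix Unit Unit K)) := by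
    refine ⟨⟨Matrix.fromBlocks 1 0 (y * T) 1, Matrix.fromBlocks 1 0 (-(y * T)) 1, ?_, ?_⟩, rfl⟩ <;>
      simp [Matrix.fromBlocks_multiply]
  have hR : IsUnit (Matrix.fromBlocks (1 : Matrix ι ι K) (T * x) 0 (1 : Matrix Unit Unit K)) := by
    refine ⟨⟨Matrix.fromBlocks 1 (T * x) 0 1, Matrix.fromBlocks 1 (-(T * x)) 0 1, ?_, ?_⟩, rfl⟩ <;>
      simp [Matrix.fromBlocks_multiply]
  have := (hL.mul hS).mul hR
  rw [Matrix.fromBlocks_multiply, Matrix.fromBlocks_multiply] at this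
  convert this using 2
  · simp
  · simp [← Matrix.mul_assoc, hST]
  · simp [Matrix.mul_assoc, hTS]
  · simp [Matrix.mul_assoc, ← Matrix.mul_assoc S T, hST]

theorem injective_of_isUnit_submatrix [Nontrivial K] {ι κ τ : Type*} [Fintype τ] [DecidableEq τ]
    {M : Matrix ι κ K} {f : τ → ι} {g : τ → κ} (h : IsUnit (M.submatrix f g)) :
    Function.Injective f ∧ Function.Injective g := by
  obtain ⟨⟨S, T, hST, hTS⟩, hS⟩ := h
  dsimp only at hS
  subst hS
  constructor <;> intro a b hab <;> by_contra hne
  · have h₁ := congrFun (congrFun hST a) a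
    have h₂ := congrFun (congrFun hST b) a
    rw [Matrix.mul_apply] at h₁ h₂
    simp only [Matrix.submatrix_apply, hab] at h₁ h₂
    rw [h₁, Matrix.one_apply_eq, Matrix.one_apply_ne (Ne.symm hne)] at h₂
    exact one_ne_zero h₂
  · have h₁ := congrFun (congrFun hTS a) a
    have h₂ := congrFun (congrFun hTS a) b
    rw [Matrix.mul_apply] at h₁ h₂
    simp only [Matrix.submatrix_apply, hab] at h₁ h₂
    rw [h₁, Matrix.one_apply_eq, Matrix.one_apply_ne hne] at h₂
    exact one_ne_zero h₂

/-- The rank factorization of a homogeneous matrix with respect to a largest invertible minor. -/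
theorem IsGradedDivisionRing.eq_mul_of_maximal_minor (h𝒦 : IsGradedDivisionRing 𝒦) {ι κ : Type*}
    [Fintype ι] [Fintype κ] {M : Matrix ι κ K} {α : ι → Γ} {β : κ → Γ} (hM : HasDegrees 𝒦 M α β)
    {k : ℕ} {f : Fin k → ι} {g : Fin k → κ} (T : Matrix (Fin k) (Fin k) K)
    (hST : M.submatrix f g * T = 1) (hTS : T * M.submatrix f g = 1)
    (hmax : ∀ (f : Fin (k + 1) → ι) (g : Fin (k + 1) → κ), ¬ IsUnit (M.submatrix f g)) :
    M = M.submatrix id g * (T * M.submatrix f id) := by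
  ext i j
  by_contra hne
  have hT := (hM.submatrix f g).of_mul_eq_one hST hTS
  have hd : HasDegrees 𝒦 (M - M.submatrix id g * (T * M.submatrix f id)) α β :=
    hM.sub ((hM.submatrix id g).mul (hT.mul (hM.submatrix f id)))
  -- This entry is the Schur complement of the minor bordered by row `i` and column `j`. Being
  -- homogeneous and nonzero, it is a unit, so the bordered minor is invertible and contradicts
  -- `hmax`.
  have hu : IsUnit ((M - M.submatrix id g * (T * M.submatrix f id)) i j) :=
    h𝒦.2 _ ⟨_, hd i j⟩ (sub_ne_zero.2 hne)
  have := isUnit_fromBlocks_of_schur hST hTS (M.submatrix f fun _ : Unit => j)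
    (M.submatrix (fun _ : Unit => i) g) (M.submatrix (fun _ => i) fun _ => j) ?_
  · let e : Fin (k + 1) ≃ Fin k ⊕ Unit := (finSumFinEquiv.symm.trans
      (Equiv.sumCongr (Equiv.refl _) (Equiv.ofUnique _ _)))
    refine hmax (Sum.elim f (fun _ => i) ∘ e) (Sum.elim g (fun _ => j) ∘ e) ?_
    have h' := this.map (Matrix.reindexRingEquiv K e.symm)
    convert h' using 1
    ext a b
    simp only [Matrix.coe_reindexRingEquiv, Matrix.reindex_apply, Matrix.submatrix_apply,
      Function.comp_apply, Equiv.symm_symm]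
    rcases e a with a | a <;> rcases e b with b | b <;> rfl
  · have h' := hu.map (Matrix.scalar Unit)
    convert h' using 1
    ext a b
    rw [Matrix.mul_assoc]
    simp [Matrix.mul_apply]

theorem exists_maximal_minor [Nontrivial K] {ι κ : Type*} [Fintype ι] (M : Matrix ι κ K) :
    ∃ (k : ℕ) (f : Fin k → ι) (g : Fin k → κ), IsUnit (M.submatrix f g) ∧
      ∀ (f : Fin (k + 1) → ι) (g : Fin (k + 1) → κ), ¬ IsUnit (M.submatrix f g) := by
  let p : ℕ → Prop := fun k => ∃ (f : Fin k → ι) (g : Fin k → κ), IsUnit (M.submatrix f g)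
  have hp : ∀ k, p k → k ≤ Fintype.card ι := by
    rintro k ⟨f, g, h⟩
    simpa using Fintype.card_le_of_injective f (injective_of_isUnit_submatrix h).1
  have h₀ : p 0 := ⟨Fin.elim0, Fin.elim0, by
    convert isUnit_one
    ext i
    exact i.elim0⟩
  classical
  obtain ⟨f, g, h⟩ := Nat.findGreatest_spec (P := p) (Nat.zero_le (Fintype.card ι)) h₀
  refine ⟨_, f, g, h, fun f' g' h' => ?_⟩
  have := Nat.le_findGreatest (P := p) (hp _ ⟨f', g', h'⟩) ⟨f', g', h'⟩
  omega

/-- A homogeneous matrix with trivial right kernel has at least as many rows as columns. -/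
theorem IsGradedDivisionRing.le_of_mulVec_injective (h𝒦 : IsGradedDivisionRing 𝒦) {r s : ℕ}
    {C : Matrix (Fin r) (Fin s) K} {α : Fin r → Γ} {β : Fin s → Γ} (hC : HasDegrees 𝒦 C α β)
    (h : ∀ x, C.mulVec x = 0 → x = 0) : s ≤ r := by
  have := h𝒦.1
  obtain ⟨k, f, g, hu, hmax⟩ := exists_maximal_minor C
  have hf := (injective_of_isUnit_submatrix hu).1
  obtain ⟨⟨S, T, hST, hTS⟩, hS⟩ := hu
  dsimp only at hS
  subst hS
  have hfac := h𝒦.eq_mul_of_maximal_minor hC T hST hTS hmax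
  set G := T * C.submatrix f id with hG
  -- The factorization of `C` shows that `C` kills each column of this difference. So the identity
  -- factors through the columns selected by `g`, which forces `g` to be surjective.
  have hzero : (1 : Matrix (Fin s) (Fin s) K) - (1 : Matrix (Fin s) (Fin s) K).submatrix id g * G
      = 0 := by
    have h₁ : C * (1 - (1 : Matrix (Fin s) (Fin s) K).submatrix id g * G) = 0 := by
      rw [Matrix.mul_sub, ← Matrix.mul_assoc, Matrix.mul_one]
      nth_rewrite 1 [hfac]
      rw [sub_eq_zero]
      congr 1
      ext
      simp [Matrix.mul_apply, Matrix.one_apply]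
    ext i j
    refine congrFun (h (Matrix.col (1 - (1 : Matrix (Fin s) (Fin s) K).submatrix id g * G) j) ?_) i
    ext l
    exact congrFun (congrFun h₁ l) j
  have hg : Function.Surjective g := by
    intro j
    by_contra! hj
    have h₁ := congrFun (congrFun hzero j) j
    rw [Matrix.sub_apply, Matrix.one_apply_eq, Matrix.mul_apply, Finset.sum_eq_zero] at h₁
    · simp at h₁
    · intro a _
      simp [Ne.symm (hj a)]
  have h₁ := Fintype.card_le_of_surjective g hg
  have h₂ := Fintype.card_le_of_injective f hf
  simp only [Fintype.card_fin] at h₁ h₂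
  omega

/-- The change of basis may be taken homogeneous, by passing to its homogeneous part, and it has
trivial kernel because the second basis is independent. It therefore has at least as many rows as
columns. -/
theorem IsGradedDivisionRing.hasGradedDim_le (h𝒦 : IsGradedDivisionRing 𝒦) {m r s : ℕ}
    {α : Fin m → Γ} {N : Submodule Kᵐᵒᵖ (Fin m → K)} (hr : HasGradedDim 𝒦 α N r)
    (hs : HasGradedDim 𝒦 α N s) : s ≤ r := by
  obtain ⟨b, hb⟩ := hr
  obtain ⟨c, hc⟩ := hs
  choose γ hγ using hb
  choose δ hδ using hc
  let B : Matrix (Fin m) (Fin r) K := Matrix.of fun i k => (b k : Fin m → K) i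
  let C : Matrix (Fin m) (Fin s) K := Matrix.of fun i k => (c k : Fin m → K) i
  have hB : HasDegrees 𝒦 B α (-γ) := fun i k => by simpa [B, sub_eq_add_neg] using hγ k i
  have hC : HasDegrees 𝒦 C α (-δ) := fun i k => by simpa [C, sub_eq_add_neg] using hδ k i
  let X : Matrix (Fin r) (Fin s) K := Matrix.of fun l k => (b.repr (c k) l).unop
  have hX : C = B * X := by
    ext i k
    have h₁ := congrArg (fun v : N => (v : Fin m → K) i) (b.sum_repr (c k))
    simp only [Submodule.coe_sum, Submodule.coe_smul, Finset.sum_apply, Pi.smul_apply] at h₁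
    exact h₁.symm
  have hX' : C = B * homogeneousPart 𝒦 (-γ) (-δ) X := by
    rw [← hB.homogeneousPart_mul, ← hX, hC.homogeneousPart_eq]
  refine h𝒦.le_of_mulVec_injective (hasDegrees_homogeneousPart (-γ) (-δ) X) fun x hx => ?_
  have h₁ : C.mulVec x = 0 := by
    rw [hX', ← Matrix.mulVec_mulVec, hx, Matrix.mulVec_zero]
  have h₂ := Fintype.linearIndependent_iff.1 c.linearIndependent (fun k => MulOpposite.op (x k)) ?_
  · ext k
    exact MulOpposite.op_injective (h₂ k)
  · ext i
    simpa [Matrix.mulVec, dotProduct, C] using congrFun h₁ i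

/-- The columns through the minor are a homogeneous basis: the minor is invertible, so they are
independent, and `eq_mul_of_maximal_minor` expresses all other columns through them. -/
theorem IsGradedDivisionRing.hasGradedRank_of_maximal_minor (h𝒦 : IsGradedDivisionRing 𝒦)
    {m n k : ℕ} {M : Matrix (Fin m) (Fin n) K} {α : Fin m → Γ} {β : Fin n → Γ}
    (hM : HasDegrees 𝒦 M α β) {f : Fin k → Fin m} {g : Fin k → Fin n}
    (hu : IsUnit (M.submatrix f g))
    (hmax : ∀ (f : Fin (k + 1) → Fin m) (g : Fin (k + 1) → Fin n), ¬ IsUnit (M.submatrix f g)) :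
    HasGradedRank 𝒦 α M k := by
  obtain ⟨⟨S, T, hST, hTS⟩, hS⟩ := hu
  dsimp only at hS
  subst hS
  have hfac := h𝒦.eq_mul_of_maximal_minor hM T hST hTS hmax
  have hli : LinearIndependent Kᵐᵒᵖ fun a => M.col (g a) := by
    rw [Fintype.linearIndependent_iff]
    intro c hc
    have h₁ : (M.submatrix f g).mulVec (fun a => (c a).unop) = 0 := by
      ext a
      simpa [Matrix.mulVec, dotProduct] using congrFun hc (f a)
    have h₂ := congrArg T.mulVec h₁
    rw [Matrix.mulVec_mulVec, hTS, Matrix.one_mulVec, Matrix.mulVec_zero] at h₂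
    exact fun a => MulOpposite.unop_injective (congrFun h₂ a)
  have hspan : Submodule.span Kᵐᵒᵖ (Set.range M.col) =
      Submodule.span Kᵐᵒᵖ (Set.range fun a => M.col (g a)) := by
    refine le_antisymm (Submodule.span_le.2 ?_) (Submodule.span_mono ?_)
    · rintro _ ⟨j, rfl⟩
      have : M.col j =
          ∑ a, MulOpposite.op ((T * M.submatrix f id) a j) • M.col (g a) := by
        ext i
        simpa [Matrix.mul_apply (M := M.submatrix id g)] using congrFun (congrFun hfac i) j
      rw [this]
      exact Submodule.sum_mem _ fun a _ =>
        Submodule.smul_mem _ _ (Submodule.subset_span ⟨a, rfl⟩)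
    · rintro _ ⟨a, rfl⟩
      exact ⟨g a, rfl⟩
  rw [HasGradedRank, hspan]
  refine ⟨Module.Basis.span hli, fun a => ⟨-β (g a), fun i => ?_⟩⟩
  rw [Module.Basis.span_apply, ← sub_eq_add_neg]
  exact hM i (g a)

end GradedDivisionRing

/-! ### Comparison with the rank over a graded division ring. -/

namespace GrPrimeMatrixIdeal

variable {Γ : Type*} [AddGroup Γ] [DecidableEq Γ] {R : Type*} [Ring R] {𝒜 : Γ → AddSubgroup R}
  [SetLike.GradedMonoid 𝒜] {K : Type*} [Ring K] {𝒦 : Γ → AddSubgroup K} [GradedRing 𝒦]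

theorem hasGradedRank_iff (P : GrPrimeMatrixIdeal 𝒜) (φ : 𝒜 →+*ᵍ 𝒦)
    (h𝒦 : IsGradedDivisionRing 𝒦) (hφ : grSingularKernel φ = P.carrier) {m n : ℕ}
    {A : Matrix (Fin m) (Fin n) R} {α : Fin m → Γ} {β : Fin n → Γ} (hA : HasDegrees 𝒜 A α β)
    (r : ℕ) : HasGradedRank 𝒦 α (A.map φ) r ↔ P.minorRank A = r := by
  have := h𝒦.1
  -- Minors of `A` are homogeneous, so for them lying outside the gr-singular kernel means exactly
  -- being invertible over `K`.
  have hmem {k : ℕ} (f : Fin k → Fin m) (g : Fin k → Fin n) :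
      IsUnit ((A.map φ).submatrix f g) ↔ ¬ P.Mem (A.submatrix f g) := by
    rw [mem_fin_iff, ← hφ]
    refine ⟨fun h h' => h'.2 h, fun h => ?_⟩
    by_contra h'
    exact h ⟨hA.isHomogeneousMatrix f g, h'⟩
  obtain ⟨f, g, h⟩ := (P.isGreatest_minorRank A).1
  have hrank : HasGradedRank 𝒦 α (A.map φ) (P.minorRank A) := by
    refine h𝒦.hasGradedRank_of_maximal_minor (hA.map φ) ((hmem f g).2 h) fun f' g' h' => ?_
    obtain ⟨hf, hg⟩ := injective_of_isUnit_submatrix h'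
    have := (P.isGreatest_minorRank A).2 ⟨⟨f', hf⟩, ⟨g', hg⟩, (hmem f' g').1 h'⟩
    omega
  constructor
  · intro hr
    exact (h𝒦.hasGradedDim_le hr hrank).antisymm (h𝒦.hasGradedDim_le hrank hr)
  · rintro rfl
    exact hrank

end GrPrimeMatrixIdeal

theorem mainTheorem8 {Γ : Type*} [AddGroup Γ] [DecidableEq Γ] {R : Type*} [Ring R]
    (𝒜 : Γ → AddSubgroup R) [GradedRing 𝒜] :
    ∃ Φ : GrPrimeMatrixIdeal 𝒜 ≃o (GrSylvesterMatrixRank 𝒜)ᵒᵈ,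
      -- the rank attached to `P` is the size of the largest square submatrix not in `P`
      (∀ (P : GrPrimeMatrixIdeal 𝒜) (m n : ℕ) (A : HomogeneousMatrix 𝒜 m n),
        IsGreatest {k : ℕ | ∃ (f : Fin k ↪o Fin m) (g : Fin k ↪o Fin n),
          A.1.submatrix f g ∉ P.carrier k} ((OrderDual.ofDual (Φ P)).rk m n A)) ∧
      -- it is the rank over any graded epic `R`-division ring with singular kernel `P`
      (∀ (P : GrPrimeMatrixIdeal 𝒜) (K : Type*) [Ring K] (𝒦 : Γ → AddSubgroup K) [GradedRing 𝒦]
        (φ : 𝒜 →+*ᵍ 𝒦), IsGradedEpicDivisionRing φ → grSingularKernel φ = P.carrier →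
        ∀ (m n : ℕ) (A : HomogeneousMatrix 𝒜 m n) (α : Fin m → Γ) (β : Fin n → Γ),
          HasDistribution 𝒜 A.1 α β → ∀ r : ℕ,
            HasGradedRank 𝒦 α (A.1.map φ) r ↔ (OrderDual.ofDual (Φ P)).rk m n A = r) ∧
      -- the inverse sends a rank function to the set of square matrices of rank less than the size
      (∀ (ρ : GrSylvesterMatrixRank 𝒜) (n : ℕ) (A : Matrix (Fin n) (Fin n) R),
        A ∈ (Φ.symm (OrderDual.toDual ρ)).carrier n ↔
          ∃ hA : IsHomogeneousMatrix 𝒜 A, ρ.rk n n ⟨A, hA⟩ < n) := by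
  refine ⟨GrPrimeMatrixIdeal.orderIsoRank, fun P m n A => P.isGreatest_toRank A, ?_,
    fun ρ n A => ρ.mem_toIdeal_iff⟩
  intro P K _ 𝒦 _ φ hφ hP m n A α β hA r
  exact P.hasGradedRank_iff φ hφ.1 hP hA r
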